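/- Let $(M,\pi)$ be a Poisson manifold, i.e. a smooth (Hausdorff, second countable) manifold with a smooth bivector field $\pi$ whose bracket $\{f,g\}_M=\pi(df,dg)$ on $C^\infty(M)$ satisfies the Jacobi identity, and let $\sharp:T^*M\to TM$, $\xi\mapsto\pi(\xi,\cdot)$, be the contraction with $\pi$. Let $C\subset M$ be a closed embedded submanifold, and let $E\subset TM|_C$ be a smooth vector subbundle with annihilator $E^\circ\subset T^*M|_C$, such that $F:=TC\cap E$ is an involutive distribution of constant rank on $C$. For a family $B$ of linear subspaces of the fibres of $TM|_C$, let $C^\infty_B(M)$ denote the set of smooth functions on $M$ whose differential, at every point of $C$, annihilates $B$. Assume that the space $\underline C:=C/F$ of leaves of $F$ is a smooth (Hausdorff) manifold such that the projection $pr:C\to\underline C$ is a submersion. If $$\sharp E^\circ\subset TC\qquad\text{and}\qquad \{C^\infty_E(M),C^\infty_E(M)\}_M\subset C^\infty_F(M),$$ then every $\underline f\in C^\infty(\underline C)$ has a lift in $C^\infty_E(M)$, i.e. there is $\hat f\in C^\infty_E(M)$ with $\hat f|_C=\underline f\circ pr$, and there is a unique Poisson structure on $\underline C$ whose bracket is computed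 by such lifts: $$\{\underline f,\underline g\}_{\underline C}\circ pr=\{\hat f,\hat g\}_M|_C$$ for all $\underline f,\underline g\in C^\infty(\underline C)$ and all lifts $\hat f,\hat g\in C^\infty_E(M)$ of $\underline f,\underline g$. -/

import Mathlib

open scoped Manifold ContDiff

noncomputable section

namespace PoissonReduction

/-! ### Poisson manifolds -/

section Poisson

variable {E H : Type*} [NormedAddCommGroup E] [NormedSpace ℝ E] [TopologicalSpace H]
  (I : ModelWithCorners ℝ E H)
  {M : Type*} [TopologicalSpace M] [ChartedSpace H M]

instance tangentSpace_finiteDimensional [FiniteDimensional ℝ E] (x : M) :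
    FiniteDimensional ℝ (TangentSpace I x) :=
  inferInstanceAs (FiniteDimensional ℝ E)

/-- The differential `df_x ∈ T_x^* M` of a real-valued function. -/
def differential (f : M → ℝ) (x : M) : Module.Dual ℝ (TangentSpace I x) :=
  ((NormedSpace.fromTangentSpace (𝕜 := ℝ) (f x)).toContinuousLinearMap.comp
    (mfderiv I 𝓘(ℝ, ℝ) f x)).toLinearMap

variable (M)

/-- A smooth bivector field on `M`: an alternating bilinear form `π_x` on each cotangent space
`T_x^* M`, such that `π(df, dg)` is a smooth function for all smooth functions `f`, `g`. -/
structure BivectorField where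
  /-- the value of the bivector field at a point, as a bilinear form on covectors -/
  toForm : ∀ x : M, LinearMap.BilinForm ℝ (Module.Dual ℝ (TangentSpace I x))
  isAlt : ∀ x, (toForm x).IsAlt
  smooth : ∀ f g : C^∞⟮I, M; ℝ⟯,
    ContMDiff I 𝓘(ℝ, ℝ) ∞ fun x => toForm x (differential I f x) (differential I g x)

variable {I M}

/-- The bracket `{f, g} = π(df, dg)` of smooth functions defined by a bivector field. -/
def BivectorField.bracket (π : BivectorField I M) (f g : C^∞⟮I, M; ℝ⟯) : C^∞⟮I, M; ℝ⟯ :=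
  ⟨fun x => π.toForm x (differential I f x) (differential I g x), π.smooth f g⟩

variable (I M) in
/-- A Poisson structure on `M`: a smooth bivector field whose bracket on `C^∞(M)` satisfies the
Jacobi identity. -/
structure PoissonStructure extends BivectorField I M where
  jacobi : ∀ f g h : C^∞⟮I, M; ℝ⟯,
    toBivectorField.bracket (toBivectorField.bracket f g) h
      + toBivectorField.bracket (toBivectorField.bracket g h) f
      + toBivectorField.bracket (toBivectorField.bracket h f) g = 0

/-- The contraction `♯ : T_x^* M → T_x M`, `ξ ↦ π(ξ, ·)`, where `T_x M` is identified with its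
bidual. -/
def BivectorField.sharp [FiniteDimensional ℝ E] (π : BivectorField I M) (x : M) :
    Module.Dual ℝ (TangentSpace I x) →ₗ[ℝ] TangentSpace I x :=
  (Module.evalEquiv ℝ (TangentSpace I x)).symm.toLinearMap ∘ₗ π.toForm x

/-- `♯ξ` is characterised by `⟨η, ♯ξ⟩ = π(ξ, η)`. -/
theorem BivectorField.apply_sharp [FiniteDimensional ℝ E] (π : BivectorField I M) (x : M)
    (ξ η : Module.Dual ℝ (TangentSpace I x)) : η (π.sharp x ξ) = π.toForm x ξ η := by
  simp [BivectorField.sharp]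

end Poisson

/-! ### Subbundles along a map, distributions and leaves -/

section Subbundle

variable {E H : Type*} [NormedAddCommGroup E] [NormedSpace ℝ E] [TopologicalSpace H]
  (I : ModelWithCorners ℝ E H)
  {M : Type*} [TopologicalSpace M] [ChartedSpace H M] [IsManifold I ∞ M]
  {E' H' : Type*} [NormedAddCommGroup E'] [NormedSpace ℝ E'] [TopologicalSpace H']
  (J : ModelWithCorners ℝ E' H')
  {C : Type*} [TopologicalSpace C] [ChartedSpace H' C] [IsManifold J ∞ C]

/-- A family of subspaces `B_c ⊆ T_{i(c)} M`, `c ∈ C`, is a smooth vector subbundle of `TM|_C`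
(the pullback of `TM` along `i : C → M`) if near each point it has a smooth frame. -/
def IsSmoothSubbundle (i : C → M) (B : ∀ c : C, Submodule ℝ (TangentSpace I (i c))) : Prop :=
  ∀ c₀ : C, ∃ (r : ℕ) (U : Set C) (s : Fin r → ∀ c : C, TangentSpace I (i c)),
    IsOpen U ∧ c₀ ∈ U ∧
    (∀ k, ContMDiffOn J I.tangent ∞ (fun c => (⟨i c, s k c⟩ : TangentBundle I M)) U) ∧
    ∀ c ∈ U, LinearIndependent ℝ (fun k => s k c) ∧ Submodule.span ℝ (Set.range fun k => s k c) = B c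

/-- The tangent space `T_c C`, as a subspace of `T_{i(c)} M`. -/
def tangentAlong (i : C → M) (c : C) : Submodule ℝ (TangentSpace I (i c)) :=
  LinearMap.range (mfderiv J I i c).toLinearMap

/-- `TC ∩ B`, as a family of subspaces of `TM|_C`. -/
def interAlong (i : C → M) (B : ∀ c : C, Submodule ℝ (TangentSpace I (i c))) (c : C) :
    Submodule ℝ (TangentSpace I (i c)) :=
  tangentAlong I J i c ⊓ B c

/-- `TC ∩ B`, as a family of subspaces of `TC`. -/
def interTangent (i : C → M) (B : ∀ c : C, Submodule ℝ (TangentSpace I (i c))) (c : C) :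
    Submodule ℝ (TangentSpace J c) :=
  (B c).comap (mfderiv J I i c).toLinearMap

/-- `C^∞_B(M)`: the smooth functions on `M` whose differential, at points of `C`,
annihilates `B`. -/
def annihilatingFunctions (i : C → M) (B : ∀ c : C, Submodule ℝ (TangentSpace I (i c))) :
    Set C^∞⟮I, M; ℝ⟯ :=
  {f | ∀ c : C, differential I f (i c) ∈ (B c).dualAnnihilator}

/-- A distribution has constant rank. -/
def HasConstantRank (F : ∀ c : C, Submodule ℝ (TangentSpace J c)) : Prop :=
  ∃ r : ℕ, ∀ c, Module.finrank ℝ (F c) = r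

/-- A distribution is involutive: the Lie bracket of two smooth vector fields with values in `F`
has values in `F`. -/
def IsInvolutive (F : ∀ c : C, Submodule ℝ (TangentSpace J c)) : Prop :=
  ∀ X Y : ∀ c : C, TangentSpace J c,
    ContMDiff J J.tangent ∞ (fun c => (⟨c, X c⟩ : TangentBundle J C)) →
    ContMDiff J J.tangent ∞ (fun c => (⟨c, Y c⟩ : TangentBundle J C)) →
    (∀ c, X c ∈ F c) → (∀ c, Y c ∈ F c) →
    ∀ c, VectorField.mlieBracket J X Y c ∈ F c

/-- Two points are joined by a (differentiable) curve `γ : [0, 1] → C` tangent to `F`. -/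
def JoinedByTangentCurve (F : ∀ c : C, Submodule ℝ (TangentSpace J c)) (x y : C) : Prop :=
  ∃ γ : ℝ → C, γ 0 = x ∧ γ 1 = y ∧
    ∀ t ∈ Set.Icc (0 : ℝ) 1, ∃ v : TangentSpace J (γ t), v ∈ F (γ t) ∧
      HasMFDerivWithinAt 𝓘(ℝ, ℝ) J γ (Set.Icc 0 1) t ((1 : ℝ →L[ℝ] ℝ).smulRight v)

/-- The partition of `C` into the leaves of `F`: two points lie in the same leaf if and only if
they are connected by a finite chain of curves tangent to `F`. -/
def leafSetoid (F : ∀ c : C, Submodule ℝ (TangentSpace J c)) : Setoid C :=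
  Relation.EqvGen.setoid (JoinedByTangentCurve J F)

/-- The leaf space `C / F`, with the quotient topology. -/
abbrev LeafSpace (F : ∀ c : C, Submodule ℝ (TangentSpace J c)) : Type _ :=
  Quotient (leafSetoid J F)

/-- The projection `C → C / F`. -/
def LeafSpace.proj (F : ∀ c : C, Submodule ℝ (TangentSpace J c)) : C → LeafSpace J F :=
  Quotient.mk (leafSetoid J F)

end Subbundle

end PoissonReduction

end

/-!
# Reduction of a Poisson structure to the leaf space of `TC ∩ E`

Write `F = TC ∩ E` and let `pr : C → C / F` be the projection.

*Lifts.* The projection is constant along curves tangent to `F`, and every vector of `F` is the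
velocity of such a curve (an integral curve of a local vector field with values in `F`), so `d pr`
kills `F`. Hence `g = f ∘ pr` satisfies `dg|_F = 0`, and it remains to extend such a `g` to a
function on `M` whose differential annihilates `E`. Near a point of `C` choose a retraction `r` of
`M` onto `C` and a map `y`, vanishing on `C`, with `ker dy = TC` along `C`. The restriction
`dy|_E` has kernel `F`, hence locally constant rank, so it has a smooth generalized inverse `σ`,
with values in `E` and `dy ∘ σ ∘ dy = dy` on `E` (`exists_local_splitting`). The function
`g ∘ r - d(g ∘ r)(σ y)` extends `g`, and its differential on `e ∈ E` is `d(g ∘ r)(e - σ dy e)`,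
which vanishes because `e - σ dy e ∈ F`. A partition of unity globalizes the extension
(`exists_extension_mem_annihilatingFunctions`). The same `σ` produces the vector fields with values
in `F` (`exists_vectorField_mem_interTangent`).

*Reduced bivector.* A covector `α` of `C / F` at `pr c` is represented by covectors `ξ ∈ E°` with
`ξ|_{TC} = pr^* α`. Two choices of `ξ` differ by an element of `TC°`, and `π(TC°, E°) = 0` since
`♯ E° ⊆ TC`; so `π` induces an alternating form on the covectors at `pr c`
(`BivectorField.exists_reduced_form`). On differentials it is `{f', g'}(c)` for lifts `f'`, `g'`.
By `{C^∞_E(M), C^∞_E(M)} ⊆ C^∞_F(M)` this function is constant along curves tangent to `F`, hence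
it only depends on `pr c`, and it is smooth on `C / F` as `pr` is a submersion.

*Jacobi identity.* The bracket `{f', g'}` of two lifts need not lie in `C^∞_E(M)`, but it agrees on
`C` with a lift of the reduced bracket, and `{·, h'}|_C` only depends on the restriction to `C` when
`h' ∈ C^∞_E(M)` (`BivectorField.bracket_congr_left`). So the Jacobi identity descends from `M`.
Uniqueness holds because every covector is the differential of a globally defined function.
-/

namespace PoissonReduction

open Topology Filter

/-! ### Generalized inverses of families of constant rank -/

section GeneralizedInverse

/-- A smooth family of linear maps of constant rank has, locally, a smooth family of generalized
inverses: `A x ∘ G x ∘ A x = A x`. Near `x₀` one inverts the square block of `A x` between a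
complement of `ker (A x₀)` and `range (A x₀)`. -/
theorem exists_contMDiffOn_generalizedInverse
    {E H : Type*} [NormedAddCommGroup E] [NormedSpace ℝ E] [TopologicalSpace H]
    {I : ModelWithCorners ℝ E H} {X : Type*} [TopologicalSpace X] [ChartedSpace H X]
    {V W : Type*} [NormedAddCommGroup V] [NormedSpace ℝ V] [FiniteDimensional ℝ V]
    [NormedAddCommGroup W] [NormedSpace ℝ W] [FiniteDimensional ℝ W]
    {U : Set X} (hU : IsOpen U) {A : X → V →L[ℝ] W} (hA : ContMDiffOn I 𝓘(ℝ, V →L[ℝ] W) ∞ A U)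
    {x₀ : X} (hx₀ : x₀ ∈ U)
    (hrank : ∀ x ∈ U, Module.finrank ℝ (LinearMap.range (A x).toLinearMap) =
      Module.finrank ℝ (LinearMap.range (A x₀).toLinearMap)) :
    ∃ (U' : Set X) (G : X → W →L[ℝ] V), IsOpen U' ∧ x₀ ∈ U' ∧ U' ⊆ U ∧
      ContMDiffOn I 𝓘(ℝ, W →L[ℝ] V) ∞ G U' ∧ ∀ x ∈ U', ∀ v, A x (G x (A x v)) = A x v := by
  set R := LinearMap.range (A x₀).toLinearMap with hR
  -- `j` embeds the range of `A x₀` as a complement of its kernel, `p` projects onto the range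
  obtain ⟨j, hj⟩ := (A x₀).toLinearMap.rangeRestrict.exists_rightInverse_of_surjective
    (A x₀).toLinearMap.range_rangeRestrict
  obtain ⟨p, hp⟩ := R.subtype.exists_leftInverse_of_injective R.ker_subtype
  let j' : R →L[ℝ] V := LinearMap.toContinuousLinearMap j
  let p' : W →L[ℝ] R := LinearMap.toContinuousLinearMap p
  let B : X → R →L[ℝ] R := fun x => p' ∘L (A x ∘L j')
  have hB : ContMDiffOn I 𝓘(ℝ, R →L[ℝ] R) ∞ B U :=
    contMDiffOn_const.clm_comp (hA.clm_comp contMDiffOn_const)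
  have hB0 : B x₀ = 1 := by
    ext1 r
    have h1 : A x₀ (j r) = r := congrArg Subtype.val (LinearMap.congr_fun hj r)
    change p (A x₀ (j r)) = r
    rw [h1]
    exact LinearMap.congr_fun hp r
  have : CompleteSpace R := FiniteDimensional.complete ℝ R
  have hunit : IsUnit (B x₀) := hB0 ▸ isUnit_one
  refine ⟨U ∩ B ⁻¹' {T | IsUnit T}, fun x => j' ∘L (Ring.inverse (B x) ∘L p'),
    hB.continuousOn.isOpen_inter_preimage hU (Units.isOpen (R := R →L[ℝ] R)), ⟨hx₀, hunit⟩,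
    Set.inter_subset_left, ?_, ?_⟩
  · have hinv : ContMDiffOn I 𝓘(ℝ, R →L[ℝ] R) ∞ (fun x => Ring.inverse (B x))
        (U ∩ B ⁻¹' {T | IsUnit T}) := by
      rintro x ⟨hxU, u, hu⟩
      have h := contDiffAt_ringInverse ℝ (R := R →L[ℝ] R) (n := ∞) u
      rw [hu] at h
      exact h.contMDiffAt.comp_contMDiffWithinAt x ((hB x hxU).mono Set.inter_subset_left)
    exact contMDiffOn_const.clm_comp (hinv.clm_comp contMDiffOn_const)
  rintro x ⟨hxU, hu : IsUnit (B x)⟩ v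
  have hl : ∀ r, Ring.inverse (B x) (B x r) = r := fun r =>
    congrArg (fun T : R →L[ℝ] R => T r) (Ring.inverse_mul_cancel _ hu)
  -- The restriction `A x ∘ j'` is injective, so by constancy of the rank it has the same range
  -- as `A x`.
  have hinj : Function.Injective ((A x).toLinearMap ∘ₗ j) := by
    intro r r' h
    rw [← hl r, ← hl r']
    exact congrArg (fun w => Ring.inverse (B x) (p w)) h
  have hrange : LinearMap.range ((A x).toLinearMap ∘ₗ j) = LinearMap.range (A x).toLinearMap := by
    refine Submodule.eq_of_le_of_finrank_eq (LinearMap.range_comp_le_range _ _) ?_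
    rw [LinearMap.finrank_range_of_inj hinj, hrank x hxU]
  obtain ⟨r, hr⟩ : A x v ∈ LinearMap.range ((A x).toLinearMap ∘ₗ j) := hrange ▸ ⟨v, rfl⟩
  rw [← hr]
  exact congrArg (fun r => A x (j r)) (hl r)

end GeneralizedInverse

/-! ### Differentials of maps between manifolds and sections along a map -/

section Derivatives

variable {E H : Type*} [NormedAddCommGroup E] [NormedSpace ℝ E] [TopologicalSpace H]
  {I : ModelWithCorners ℝ E H}
  {M : Type*} [TopologicalSpace M] [ChartedSpace H M]
  {E' H' : Type*} [NormedAddCommGroup E'] [NormedSpace ℝ E'] [TopologicalSpace H']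
  {J : ModelWithCorners ℝ E' H'}
  {C : Type*} [TopologicalSpace C] [ChartedSpace H' C]
  {W : Type*} [NormedAddCommGroup W] [NormedSpace ℝ W]

theorem differential_apply (f : M → ℝ) (x : M) (v : TangentSpace I x) :
    differential I f x v = mvfderiv I f x v := rfl

theorem mvfderiv_congr {f g : M → W} {x : M} (h : f =ᶠ[𝓝 x] g) :
    ∀ v, mvfderiv I f x v = mvfderiv I g x v := by
  intro v
  have := h.mfderiv_eq (I := I) (I' := 𝓘(ℝ, W))
  exact congrArg (fun T : E →L[ℝ] W => T v) this

theorem mvfderiv_comp_map {g : M → W} {f : C → M} (x : C)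
    (hg : MDifferentiableAt I 𝓘(ℝ, W) g (f x)) (hf : MDifferentiableAt J I f x)
    (v : TangentSpace J x) :
    mvfderiv J (g ∘ f) x v = mvfderiv I g (f x) (mfderiv J I f x v) :=
  mfderiv_comp_apply x hg hf v

variable [IsManifold I ∞ M]

/-- The differential of a smooth map carries smooth sections of `TM` along `i` to smooth sections
along `y ∘ i`. -/
theorem contMDiffAt_mfderiv_section {E'' H'' : Type*} [NormedAddCommGroup E'']
    [NormedSpace ℝ E''] [TopologicalSpace H''] {K : ModelWithCorners ℝ E'' H''}
    {N : Type*} [TopologicalSpace N] [ChartedSpace H'' N] [IsManifold K ∞ N]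
    {V : Set M} (hV : IsOpen V) {y : M → N} (hy : ContMDiffOn I K ∞ y V)
    {i : C → M} {s : ∀ c, TangentSpace I (i c)} {c₀ : C} (hc₀ : i c₀ ∈ V)
    (hs : ContMDiffAt J I.tangent ∞ (fun c => (⟨i c, s c⟩ : TangentBundle I M)) c₀) :
    ContMDiffAt J K.tangent ∞
      (fun c => (⟨y (i c), mfderiv I K y (i c) (s c)⟩ : TangentBundle K N)) c₀ := by
  have : IsManifold I 1 M := IsManifold.of_le (n := ∞) (by simp)
  have : IsManifold K 1 N := IsManifold.of_le (n := ∞) (by simp)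
  have hT := hy.contMDiffOn_tangentMapWithin (m := ∞) (by simp) hV.uniqueMDiffOn
  have hopen : IsOpen (Bundle.TotalSpace.proj ⁻¹' V : Set (TangentBundle I M)) :=
    hV.preimage (FiberBundle.continuous_proj E (TangentSpace I))
  have hT₀ := hT.contMDiffAt (x := (⟨i c₀, s c₀⟩ : TangentBundle I M)) (hopen.mem_nhds hc₀)
  have hcomp := hT₀.comp c₀ hs
  refine hcomp.congr_of_eventuallyEq ?_
  have hmem : ∀ᶠ c in 𝓝 c₀, i c ∈ V :=
    hs.continuousAt.eventually_mem (hopen.mem_nhds hc₀)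
  filter_upwards [hmem] with c hc
  simp [tangentMapWithin, mfderivWithin_of_isOpen hV hc]

/-- `contMDiffAt_mfderiv_section` for a map to a normed space, where the differential takes values
in that space. -/
theorem contMDiffAt_mvfderiv_section
    {V : Set M} (hV : IsOpen V) {y : M → W} (hy : ContMDiffOn I 𝓘(ℝ, W) ∞ y V)
    {i : C → M} {s : ∀ c, TangentSpace I (i c)} {c₀ : C} (hc₀ : i c₀ ∈ V)
    (hs : ContMDiffAt J I.tangent ∞ (fun c => (⟨i c, s c⟩ : TangentBundle I M)) c₀) :
    ContMDiffAt J 𝓘(ℝ, W) ∞ (fun c => mvfderiv I y (i c) (s c)) c₀ :=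
  (contMDiff_snd_tangentBundle_modelSpace W 𝓘(ℝ, W)).contMDiffAt.comp c₀
    (contMDiffAt_mfderiv_section (K := 𝓘(ℝ, W)) hV hy hc₀ hs)

/-- Linear combinations of smooth sections of `TM` along `i`, with smooth coefficients, are smooth.
(Mathlib has this for sections over `M` itself.) -/
theorem contMDiffAt_sum_smul_section_along {ι : Type*} [Fintype ι] {c₀ : C} {i : C → M}
    (hi : ContMDiffAt J I ∞ i c₀) {a : ι → C → ℝ} {s : ι → ∀ c, TangentSpace I (i c)}
    (ha : ∀ k, ContMDiffAt J 𝓘(ℝ, ℝ) ∞ (a k) c₀)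
    (hs : ∀ k, ContMDiffAt J I.tangent ∞ (fun c => (⟨i c, s k c⟩ : TangentBundle I M)) c₀) :
    ContMDiffAt J I.tangent ∞
      (fun c => (⟨i c, ∑ k, a k c • s k c⟩ : TangentBundle I M)) c₀ := by
  have : IsManifold I 1 M := IsManifold.of_le (n := ∞) (by simp)
  rw [Bundle.contMDiffAt_totalSpace]
  refine ⟨hi, ?_⟩
  set e := trivializationAt E (TangentSpace I : M → Type _) (i c₀) with he
  have hlin : ∀ c, i c ∈ e.baseSet →
      (e ⟨i c, ∑ k, a k c • s k c⟩).2 = ∑ k, a k c • (e ⟨i c, s k c⟩).2 := by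
    intro c hc
    have h := e.coe_linearMapAt_of_mem (R := ℝ) hc
    have h' : ∀ v : TangentSpace I (i c), e.linearMapAt ℝ (i c) v = (e ⟨i c, v⟩).2 := congrFun h
    simp only [← h', map_sum, map_smul]
  have hsmooth : ContMDiffAt J 𝓘(ℝ, E) ∞ (fun c => ∑ k, a k c • (e ⟨i c, s k c⟩).2) c₀ :=
    contMDiffAt_finsetSum fun k _ =>
      (ha k).smul (Bundle.contMDiffAt_totalSpace.1 (hs k)).2
  have hmem : i c₀ ∈ e.baseSet := FiberBundle.mem_baseSet_trivializationAt' (i c₀)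
  refine hsmooth.congr_of_eventuallyEq ?_
  filter_upwards [hi.continuousAt (e.open_baseSet.mem_nhds hmem)] with c hc
  exact hlin c hc

end Derivatives

/-! ### Rules for derivatives of vector-valued functions -/

section VectorValuedDerivatives

variable {E H : Type*} [NormedAddCommGroup E] [NormedSpace ℝ E] [TopologicalSpace H]
  {I : ModelWithCorners ℝ E H} {M : Type*} [TopologicalSpace M] [ChartedSpace H M]
  {W W' : Type*} [NormedAddCommGroup W] [NormedSpace ℝ W]
  [NormedAddCommGroup W'] [NormedSpace ℝ W']

theorem mvfderiv_clm_comp (L : W →L[ℝ] W') {f : M → W} {x : M}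
    (hf : MDifferentiableAt I 𝓘(ℝ, W) f x) (v : TangentSpace I x) :
    mvfderiv I (fun p => L (f p)) x v = L (mvfderiv I f x v) := by
  have h := (L.hasMFDerivAt (x := f x)).comp x hf.hasMFDerivAt
  exact congrArg (fun T : E →L[ℝ] W' => T v) h.mfderiv

theorem mvfderiv_finset_sum {ι : Type*} (t : Finset ι) {f : ι → M → W} {x : M}
    (hf : ∀ j ∈ t, MDifferentiableAt I 𝓘(ℝ, W) (f j) x) (v : TangentSpace I x) :
    mvfderiv I (fun p => ∑ j ∈ t, f j p) x v = ∑ j ∈ t, mvfderiv I (f j) x v := by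
  suffices h : MDifferentiableAt I 𝓘(ℝ, W) (fun p => ∑ j ∈ t, f j p) x ∧
      mvfderiv I (fun p => ∑ j ∈ t, f j p) x v = ∑ j ∈ t, mvfderiv I (f j) x v from h.2
  classical
  induction t using Finset.induction_on with
  | empty => simp [mdifferentiableAt_const, mvfderiv_const]
  | insert k t hk ih =>
    obtain ⟨h1, h2⟩ := ih fun j hj => hf j (Finset.mem_insert_of_mem hj)
    have h3 := hf k (Finset.mem_insert_self k t)
    simp only [Finset.sum_insert hk]
    refine ⟨h3.add h1, ?_⟩
    rw [← h2]
    have h4 := mvfderiv_add (I := I) h3 h1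
    exact congrArg (fun T : E →L[ℝ] W => T v) h4

theorem mvfderiv_mul_apply {f g : M → ℝ} {x : M} (hf : MDifferentiableAt I 𝓘(ℝ, ℝ) f x)
    (hg : MDifferentiableAt I 𝓘(ℝ, ℝ) g x) (v : TangentSpace I x) :
    mvfderiv I (fun p => f p * g p) x v = f x * mvfderiv I g x v + g x * mvfderiv I f x v := by
  have := mvfderiv_mul (I := I) hf hg
  exact congrArg (fun T : E →L[ℝ] ℝ => T v) this

theorem mvfderiv_sub_apply {f g : M → W} {x : M} (hf : MDifferentiableAt I 𝓘(ℝ, W) f x)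
    (hg : MDifferentiableAt I 𝓘(ℝ, W) g x) (v : TangentSpace I x) :
    mvfderiv I (fun p => f p - g p) x v = mvfderiv I f x v - mvfderiv I g x v := by
  have := mvfderiv_sub (I := I) hf hg
  exact congrArg (fun T : E →L[ℝ] W => T v) this

end VectorValuedDerivatives

/-! ### Local retractions onto an embedded submanifold -/

section Retraction

variable {E E' : Type*} [NormedAddCommGroup E] [NormedSpace ℝ E] [NormedAddCommGroup E']
  [NormedSpace ℝ E'] {M : Type*} [TopologicalSpace M] [ChartedSpace E M]
  {C : Type*} [TopologicalSpace C] [ChartedSpace E' C]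

theorem mfderiv_retraction_apply {i : C → M} {r : M → C} {c : C}
    (hi : MDifferentiableAt 𝓘(ℝ, E') 𝓘(ℝ, E) i c)
    (hr : MDifferentiableAt 𝓘(ℝ, E) 𝓘(ℝ, E') r (i c))
    (h : ∀ᶠ c' in 𝓝 c, r (i c') = c') (v : TangentSpace 𝓘(ℝ, E') c) :
    (mfderiv 𝓘(ℝ, E) 𝓘(ℝ, E') r (i c) (mfderiv 𝓘(ℝ, E') 𝓘(ℝ, E) i c v) : E') = v := by
  have h1 := mfderiv_comp_apply c hr hi v
  have h2 : (r ∘ i) =ᶠ[𝓝 c] id := h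
  have h3 : mfderiv 𝓘(ℝ, E') 𝓘(ℝ, E') (r ∘ i) c v = (v : E') := by
    have := congrArg (fun T : E' →L[ℝ] E' => T v)
      (h2.mfderiv_eq (I := 𝓘(ℝ, E')) (I' := 𝓘(ℝ, E')))
    refine this.trans ?_
    rw [mfderiv_id]; rfl
  exact h1.symm.trans h3

/-- In immersion charts `i` is `u ↦ (u, 0)`, and the retraction is `(u, v) ↦ u`. That `i` is a
topological embedding ensures that no other sheet of `C` enters `V`. -/
theorem exists_local_retraction {i : C → M}
    (hi : Manifold.IsSmoothEmbedding 𝓘(ℝ, E') 𝓘(ℝ, E) ∞ i) (c₀ : C) :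
    ∃ (V : Set M) (r : M → C), IsOpen V ∧ i c₀ ∈ V ∧
      ContMDiffOn 𝓘(ℝ, E) 𝓘(ℝ, E') ∞ r V ∧ ∀ c, i c ∈ V → r (i c) = c := by
  have h := hi.isImmersion.isImmersionAt c₀
  obtain ⟨O, hO, hOi⟩ := hi.isEmbedding.isInducing.isOpen_iff.1 h.domChart.open_source
  set φ := h.domChart with hφ
  set ψ := h.codChart with hψ
  let pr : E →L[ℝ] E' := ContinuousLinearMap.fst ℝ E' h.complement ∘L h.equiv.symm
  have hwr : ∀ c ∈ φ.source, pr (ψ (i c)) = φ c := by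
    intro c hc
    have hmem : φ c ∈ (φ.extend 𝓘(ℝ, E')).target := by simpa using φ.map_source hc
    have hw := h.writtenInCharts hmem
    have hw' : ψ (i c) = h.equiv (φ c, 0) := by
      simpa [← hφ, ← hψ, φ.left_inv hc] using hw
    simp [pr, hw']
  have hc₀ : c₀ ∈ φ.source := h.mem_domChart_source
  refine ⟨(ψ.source ∩ ψ ⁻¹' (pr ⁻¹' φ.target)) ∩ O, fun p => φ.symm (pr (ψ p)),
    (ψ.isOpen_inter_preimage (φ.open_target.preimage pr.continuous)).inter hO,
    ⟨⟨h.mem_codChart_source, ?_⟩, ?_⟩, ?_, ?_⟩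
  · change pr (ψ (i c₀)) ∈ φ.target
    rw [hwr c₀ hc₀]
    exact φ.map_source hc₀
  · change c₀ ∈ i ⁻¹' O
    rwa [hOi]
  · have h1 : ContMDiffOn 𝓘(ℝ, E) 𝓘(ℝ, E) ∞ ψ ψ.source :=
      contMDiffOn_of_mem_maximalAtlas h.codChart_mem_maximalAtlas
    have h2 : ContMDiffOn 𝓘(ℝ, E') 𝓘(ℝ, E') ∞ φ.symm φ.target :=
      contMDiffOn_symm_of_mem_maximalAtlas h.domChart_mem_maximalAtlas
    exact h2.comp (pr.contMDiff.comp_contMDiffOn (h1.mono fun p hp => hp.1.1)) fun p hp => hp.1.2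
  · intro c hc
    have hcφ : c ∈ φ.source := by rw [← hOi]; exact hc.2
    change φ.symm (pr (ψ (i c))) = c
    rw [hwr c hcφ, φ.left_inv hcφ]

variable [IsManifold 𝓘(ℝ, E) ∞ M]

/-- With a retraction `r` and a chart `ψ` of `M`, the map `y = ψ - ψ ∘ i ∘ r` vanishes on `C` and
its differential at points of `C` is `dψ ∘ (1 - d(i ∘ r))`, whose kernel is the tangent space
of `C`. -/
theorem exists_local_retraction_and_defining_map {i : C → M}
    (hi : Manifold.IsSmoothEmbedding 𝓘(ℝ, E') 𝓘(ℝ, E) ∞ i) (c₀ : C) :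
    ∃ (V : Set M) (r : M → C) (y : M → E), IsOpen V ∧ i c₀ ∈ V ∧
      ContMDiffOn 𝓘(ℝ, E) 𝓘(ℝ, E') ∞ r V ∧ ContMDiffOn 𝓘(ℝ, E) 𝓘(ℝ, E) ∞ y V ∧
      ∀ c, i c ∈ V → r (i c) = c ∧ y (i c) = 0 ∧
        ∀ w : TangentSpace 𝓘(ℝ, E) (i c), mvfderiv 𝓘(ℝ, E) y (i c) w = 0 ↔
          w ∈ tangentAlong 𝓘(ℝ, E) 𝓘(ℝ, E') i c := by
  obtain ⟨V, r, hV, hc₀, hr, hri⟩ := exists_local_retraction hi c₀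
  have hism := hi.contMDiff
  set ψ := chartAt E (i c₀) with hψ
  have hψs : ContMDiffOn 𝓘(ℝ, E) 𝓘(ℝ, E) ∞ ψ ψ.source := contMDiffOn_chart
  have hir : ContMDiffOn 𝓘(ℝ, E) 𝓘(ℝ, E) ∞ (i ∘ r) V := hism.comp_contMDiffOn hr
  have hV' : IsOpen (V ∩ (i ∘ r) ⁻¹' ψ.source) :=
    hir.continuousOn.isOpen_inter_preimage hV ψ.open_source
  have hchart : i c₀ ∈ ψ.source := mem_chart_source E (i c₀)
  refine ⟨(V ∩ (i ∘ r) ⁻¹' ψ.source) ∩ ψ.source, r, fun p => ψ p - ψ (i (r p)),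
    hV'.inter ψ.open_source, ⟨⟨hc₀, ?_⟩, hchart⟩,
    hr.mono fun p hp => hp.1.1, ?_, ?_⟩
  · simpa [hri c₀ hc₀] using hchart
  · exact (hψs.mono fun p hp => hp.2).sub
      (hψs.comp (hir.mono fun p hp => hp.1.1) fun p hp => hp.1.2)
  · rintro c ⟨⟨hcV, -⟩, hcψ⟩
    have hrc := hri c hcV
    refine ⟨hrc, by simp [hrc], fun w => ?_⟩
    have hψd : MDifferentiableAt 𝓘(ℝ, E) 𝓘(ℝ, E) ψ (i c) :=
      (hψs.contMDiffAt (ψ.open_source.mem_nhds hcψ)).mdifferentiableAt (by simp)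
    have hψd' : MDifferentiableAt 𝓘(ℝ, E) 𝓘(ℝ, E) ψ (i (r (i c))) := by rwa [hrc]
    have hrd : MDifferentiableAt 𝓘(ℝ, E) 𝓘(ℝ, E') r (i c) :=
      (hr.contMDiffAt (hV.mem_nhds hcV)).mdifferentiableAt (by simp)
    have hid : MDifferentiableAt 𝓘(ℝ, E') 𝓘(ℝ, E) i (r (i c)) :=
      hism.contMDiffAt.mdifferentiableAt (by simp)
    have hird : MDifferentiableAt 𝓘(ℝ, E) 𝓘(ℝ, E) (i ∘ r) (i c) := hid.comp _ hrd
    have hnear : ∀ᶠ c' in 𝓝 c, r (i c') = c' := by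
      filter_upwards [(hV.preimage hism.continuous).mem_nhds hcV] with c' hc' using hri c' hc'
    have hd : mvfderiv 𝓘(ℝ, E) (fun p => ψ p - ψ (i (r p))) (i c) w =
        mvfderiv 𝓘(ℝ, E) ψ (i c) w - mvfderiv 𝓘(ℝ, E) (ψ ∘ (i ∘ r)) (i c) w := by
      have := mvfderiv_sub (I := 𝓘(ℝ, E)) hψd (hψd'.comp (i c) hird)
      exact congrArg (fun T : E →L[ℝ] E => T w) this
    rw [hd, mvfderiv_comp_map (i c) hψd' hird, sub_eq_zero]
    have hinj : Function.Injective (mvfderiv 𝓘(ℝ, E) ψ (i c)) :=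
      (mdifferentiable_chart (I := 𝓘(ℝ, E)) (i c₀)).mfderiv_injective hcψ
    have e1 : (mfderiv 𝓘(ℝ, E) 𝓘(ℝ, E) (i ∘ r) (i c) w : E) =
        mfderiv 𝓘(ℝ, E') 𝓘(ℝ, E) i (r (i c)) (mfderiv 𝓘(ℝ, E) 𝓘(ℝ, E') r (i c) w) :=
      mfderiv_comp_apply (i c) hid hrd w
    have e2 : (mvfderiv 𝓘(ℝ, E) ψ (i (r (i c))) : E →L[ℝ] E) = mvfderiv 𝓘(ℝ, E) ψ (i c) :=
      congrArg (β := E →L[ℝ] E) (fun c' : C => mvfderiv 𝓘(ℝ, E) ψ (i c')) hrc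
    have e3 : (mfderiv 𝓘(ℝ, E') 𝓘(ℝ, E) i (r (i c)) : E' →L[ℝ] E) =
        mfderiv 𝓘(ℝ, E') 𝓘(ℝ, E) i c :=
      congrArg (β := E' →L[ℝ] E) (fun c' : C => mfderiv 𝓘(ℝ, E') 𝓘(ℝ, E) i c') hrc
    have e4 : mvfderiv 𝓘(ℝ, E) ψ ((i ∘ r) (i c)) (mfderiv 𝓘(ℝ, E) 𝓘(ℝ, E) (i ∘ r) (i c) w) =
        mvfderiv 𝓘(ℝ, E) ψ (i c) (mfderiv 𝓘(ℝ, E') 𝓘(ℝ, E) i c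
          (mfderiv 𝓘(ℝ, E) 𝓘(ℝ, E') r (i c) w : E')) := by
      rw [e1]
      exact (congrArg (fun T : E →L[ℝ] E => T _) e2).trans
        (congrArg (fun T : E' →L[ℝ] E => mvfderiv 𝓘(ℝ, E) ψ (i c)
          (T (mfderiv 𝓘(ℝ, E) 𝓘(ℝ, E') r (i c) w : E'))) e3)
    rw [e4]
    constructor
    · intro hw
      exact ⟨_, (hinj hw).symm⟩
    · rintro ⟨v, rfl⟩
      exact congrArg (fun v : E' => mvfderiv 𝓘(ℝ, E) ψ (i c) (mfderiv 𝓘(ℝ, E') 𝓘(ℝ, E) i c v))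
        (mfderiv_retraction_apply (hism.contMDiffAt.mdifferentiableAt (by simp)) hrd
          hnear v).symm

end Retraction

/-! ### A smooth splitting of a subbundle over its image in the normal directions -/

section Splitting

variable {E E' : Type*} [NormedAddCommGroup E] [NormedSpace ℝ E] [FiniteDimensional ℝ E]
  [NormedAddCommGroup E'] [NormedSpace ℝ E']
  {M : Type*} [TopologicalSpace M] [ChartedSpace E M] [IsManifold 𝓘(ℝ, E) ∞ M]
  {C : Type*} [TopologicalSpace C] [ChartedSpace E' C]

/-- Rank–nullity for `d ∘ f`, with the kernel identified with a subspace of the source of `g`. -/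
theorem finrank_range_comp_add_finrank_comap {V W T S : Type*}
    [AddCommGroup V] [Module ℝ V] [FiniteDimensional ℝ V] [AddCommGroup W] [Module ℝ W]
    [AddCommGroup T] [Module ℝ T] [AddCommGroup S] [Module ℝ S]
    {f : V →ₗ[ℝ] T} (hf : Function.Injective f) {g : S →ₗ[ℝ] T} (hg : Function.Injective g)
    {d : T →ₗ[ℝ] W} (hd : LinearMap.ker d = LinearMap.range g) :
    Module.finrank ℝ (LinearMap.range (d ∘ₗ f)) +
      Module.finrank ℝ ((LinearMap.range f).comap g) = Module.finrank ℝ V := by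
  rw [← LinearMap.finrank_range_add_finrank_ker (d ∘ₗ f), LinearMap.ker_comp, hd,
    (Submodule.equivMapOfInjective f hf _).finrank_eq,
    (Submodule.equivMapOfInjective g hg _).finrank_eq, Submodule.map_comap_eq,
    Submodule.map_comap_eq, inf_comm]

/-- If `TC ∩ B` has constant rank, the restriction of `dy` to `B` has locally a smooth generalized
inverse `σ` with values in `B`. It is obtained from a local frame of `B`. -/
theorem exists_local_splitting {i : C → M} (hi : ContMDiff 𝓘(ℝ, E') 𝓘(ℝ, E) ∞ i)
    {B : ∀ c : C, Submodule ℝ (TangentSpace 𝓘(ℝ, E) (i c))}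
    (hB : IsSmoothSubbundle 𝓘(ℝ, E) 𝓘(ℝ, E') i B)
    (hrank : HasConstantRank 𝓘(ℝ, E') (interTangent 𝓘(ℝ, E) 𝓘(ℝ, E') i B))
    {V : Set M} (hV : IsOpen V) {y : M → E} (hy : ContMDiffOn 𝓘(ℝ, E) 𝓘(ℝ, E) ∞ y V)
    (hinj : ∀ c, i c ∈ V → Function.Injective (mfderiv 𝓘(ℝ, E') 𝓘(ℝ, E) i c))
    (hker : ∀ c, i c ∈ V → ∀ w : TangentSpace 𝓘(ℝ, E) (i c),
      mvfderiv 𝓘(ℝ, E) y (i c) w = 0 ↔ w ∈ tangentAlong 𝓘(ℝ, E) 𝓘(ℝ, E') i c)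
    {c₀ : C} (hc₀ : i c₀ ∈ V) :
    ∃ (U : Set C) (σ : ∀ c : C, E →ₗ[ℝ] TangentSpace 𝓘(ℝ, E) (i c)),
      IsOpen U ∧ c₀ ∈ U ∧ U ⊆ i ⁻¹' V ∧
      (∀ v : C → E, ∀ c ∈ U, ContMDiffAt 𝓘(ℝ, E') 𝓘(ℝ, E) ∞ v c →
        ContMDiffAt 𝓘(ℝ, E') 𝓘(ℝ, E).tangent ∞
          (fun c => (⟨i c, σ c (v c)⟩ : TangentBundle 𝓘(ℝ, E) M)) c) ∧
      ∀ c ∈ U, (∀ v, σ c v ∈ B c) ∧ ∀ e ∈ B c,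
        mvfderiv 𝓘(ℝ, E) y (i c) (σ c (mvfderiv 𝓘(ℝ, E) y (i c) e)) =
          mvfderiv 𝓘(ℝ, E) y (i c) e := by
  obtain ⟨k, U, s, hU, hcU, hs, hspan⟩ := hB c₀
  let S : ∀ c, (Fin k → ℝ) →ₗ[ℝ] TangentSpace 𝓘(ℝ, E) (i c) :=
    fun c => Fintype.linearCombination ℝ (fun l => s l c)
  have hSapp : ∀ c t, S c t = ∑ l, t l • s l c := fun c t => rfl
  have hSrange : ∀ c ∈ U, LinearMap.range (S c) = B c := fun c hc => by
    rw [← (hspan c hc).2]; exact Fintype.range_linearCombination ℝ _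
  have hSinj : ∀ c ∈ U, Function.Injective (S c) := fun c hc =>
    (hspan c hc).1.fintypeLinearCombination_injective
  let d : ∀ c, TangentSpace 𝓘(ℝ, E) (i c) →L[ℝ] E := fun c => mvfderiv 𝓘(ℝ, E) y (i c)
  let A : C → (Fin k → ℝ) →L[ℝ] E := fun c =>
    ∑ l, (ContinuousLinearMap.proj (R := ℝ) (φ := fun _ : Fin k => ℝ) l).smulRight (d c (s l c))
  have hA : ∀ c t, A c t = d c (S c t) := fun c t => by
    simp [A, hSapp, map_sum]
  have hU₁ : IsOpen (U ∩ i ⁻¹' V) := hU.inter (hV.preimage hi.continuous)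
  have hAs : ContMDiffOn 𝓘(ℝ, E') 𝓘(ℝ, (Fin k → ℝ) →L[ℝ] E) ∞ A (U ∩ i ⁻¹' V) := by
    refine contMDiffOn_finsetSum fun l _ => ?_
    have h1 : ContMDiffOn 𝓘(ℝ, E') 𝓘(ℝ, E) ∞ (fun c => d c (s l c)) (U ∩ i ⁻¹' V) := fun c hc =>
      (contMDiffAt_mvfderiv_section hV hy hc.2
        ((hs l).contMDiffAt (hU.mem_nhds hc.1))).contMDiffWithinAt
    exact (ContinuousLinearMap.smulRightL ℝ (Fin k → ℝ) E
      (ContinuousLinearMap.proj (R := ℝ) (φ := fun _ : Fin k => ℝ) l)).contMDiff.comp_contMDiffOn h1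
  obtain ⟨r, hr⟩ := hrank
  -- by rank–nullity, `A c` has constant rank because its kernel is isomorphic to `TC ∩ B`
  have hrankA : ∀ c ∈ U ∩ i ⁻¹' V,
      Module.finrank ℝ (LinearMap.range (A c).toLinearMap) + r = k := by
    intro c hc
    have h1 := finrank_range_comp_add_finrank_comap (hSinj c hc.1)
      (g := (mfderiv 𝓘(ℝ, E') 𝓘(ℝ, E) i c).toLinearMap) (hinj c hc.2)
      (d := (d c).toLinearMap) (by ext w; exact hker c hc.2 w)
    have h2 : (A c).toLinearMap = (d c).toLinearMap ∘ₗ S c := by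
      apply LinearMap.ext; exact hA c
    rw [hSrange c hc.1, Module.finrank_fin_fun] at h1
    have h3 : Module.finrank ℝ
        ((B c).comap (mfderiv 𝓘(ℝ, E') 𝓘(ℝ, E) i c).toLinearMap) = r := hr c
    rwa [h3, ← h2] at h1
  obtain ⟨U', G, hU', hcU', hUU', hG, hAG⟩ := exists_contMDiffOn_generalizedInverse hU₁ hAs
    (x₀ := c₀) ⟨hcU, hc₀⟩ fun c hc => by have := hrankA c hc; have := hrankA c₀ ⟨hcU, hc₀⟩; omega
  refine ⟨U', fun c => S c ∘ₗ (G c).toLinearMap, hU', hcU', fun c hc => (hUU' hc).2, ?_, ?_⟩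
  · intro v c hc hv
    have hGv : ContMDiffAt 𝓘(ℝ, E') 𝓘(ℝ, Fin k → ℝ) ∞ (fun c => G c (v c)) c :=
      (hG.contMDiffAt (hU'.mem_nhds hc)).clm_apply hv
    exact contMDiffAt_sum_smul_section_along hi.contMDiffAt (contMDiffAt_pi_space.1 hGv)
      fun l => (hs l).contMDiffAt (hU.mem_nhds (hUU' hc).1)
  · intro c hc
    have hcU := (hUU' hc).1
    refine ⟨fun v => hSrange c hcU ▸ ⟨_, rfl⟩, fun e he => ?_⟩
    obtain ⟨t, rfl⟩ : e ∈ LinearMap.range (S c) := by rwa [hSrange c hcU]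
    have := hAG c hc t
    rwa [hA, hA] at this

end Splitting

/-! ### Local extension of functions -/

section Extension

variable {E E' : Type*} [NormedAddCommGroup E] [NormedSpace ℝ E] [FiniteDimensional ℝ E]
  [NormedAddCommGroup E'] [NormedSpace ℝ E']
  {M : Type*} [TopologicalSpace M] [ChartedSpace E M] [IsManifold 𝓘(ℝ, E) ∞ M]
  {C : Type*} [TopologicalSpace C] [ChartedSpace E' C]

/-- The local data around a point of `C` used below: a retraction `r`, a map `y` vanishing on `C`,
and `σ` such that `e - σ (dy e) ∈ TC ∩ B` for every `e ∈ B`. -/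
theorem exists_local_retraction_and_splitting {i : C → M}
    (hi : Manifold.IsSmoothEmbedding 𝓘(ℝ, E') 𝓘(ℝ, E) ∞ i)
    {B : ∀ c : C, Submodule ℝ (TangentSpace 𝓘(ℝ, E) (i c))}
    (hB : IsSmoothSubbundle 𝓘(ℝ, E) 𝓘(ℝ, E') i B)
    (hrank : HasConstantRank 𝓘(ℝ, E') (interTangent 𝓘(ℝ, E) 𝓘(ℝ, E') i B)) (c₀ : C) :
    ∃ (V : Set M) (r : M → C) (y : M → E) (U : Set C)
      (σ : ∀ c : C, E →ₗ[ℝ] TangentSpace 𝓘(ℝ, E) (i c)),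
      IsOpen V ∧ i c₀ ∈ V ∧ ContMDiffOn 𝓘(ℝ, E) 𝓘(ℝ, E') ∞ r V ∧
      ContMDiffOn 𝓘(ℝ, E) 𝓘(ℝ, E) ∞ y V ∧
      (∀ c, i c ∈ V → r (i c) = c ∧ y (i c) = 0 ∧ ∀ v : TangentSpace 𝓘(ℝ, E') c,
        (mfderiv 𝓘(ℝ, E) 𝓘(ℝ, E') r (i c) (mfderiv 𝓘(ℝ, E') 𝓘(ℝ, E) i c v) : E') = v) ∧
      IsOpen U ∧ c₀ ∈ U ∧ U ⊆ i ⁻¹' V ∧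
      (∀ v : C → E, ∀ c ∈ U, ContMDiffAt 𝓘(ℝ, E') 𝓘(ℝ, E) ∞ v c →
        ContMDiffAt 𝓘(ℝ, E') 𝓘(ℝ, E).tangent ∞
          (fun c => (⟨i c, σ c (v c)⟩ : TangentBundle 𝓘(ℝ, E) M)) c) ∧
      ∀ c ∈ U, ∀ e ∈ B c,
        ∃ v ∈ interTangent 𝓘(ℝ, E) 𝓘(ℝ, E') i B c,
          e - σ c (mvfderiv 𝓘(ℝ, E) y (i c) e) = mfderiv 𝓘(ℝ, E') 𝓘(ℝ, E) i c v := by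
  obtain ⟨V, r, y, hV, hc₀, hr, hy, hVc⟩ := exists_local_retraction_and_defining_map hi c₀
  have hism := hi.contMDiff
  have hri : ∀ c, i c ∈ V → ∀ v : TangentSpace 𝓘(ℝ, E') c,
      (mfderiv 𝓘(ℝ, E) 𝓘(ℝ, E') r (i c) (mfderiv 𝓘(ℝ, E') 𝓘(ℝ, E) i c v) : E') = v := by
    intro c hc v
    refine mfderiv_retraction_apply (hism.contMDiffAt.mdifferentiableAt (by simp))
      ((hr.contMDiffAt (hV.mem_nhds hc)).mdifferentiableAt (by simp)) ?_ v
    filter_upwards [(hV.preimage hism.continuous).mem_nhds hc] with c' hc' using (hVc c' hc').1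
  have hinj : ∀ c, i c ∈ V → Function.Injective (mfderiv 𝓘(ℝ, E') 𝓘(ℝ, E) i c) := by
    intro c hc v v' h
    have h1 := hri c hc v
    rw [h] at h1
    exact h1.symm.trans (hri c hc v')
  obtain ⟨U, σ, hU, hcU, hUV, hσ, hUc⟩ := exists_local_splitting hism hB hrank hV hy hinj
    (fun c hc => (hVc c hc).2.2) hc₀
  refine ⟨V, r, y, U, σ, hV, hc₀, hr, hy, fun c hc => ⟨(hVc c hc).1, (hVc c hc).2.1, hri c hc⟩,
    hU, hcU, hUV, hσ, fun c hc e he => ?_⟩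
  obtain ⟨h1, h2⟩ := hUc c hc
  have hmem : e - σ c (mvfderiv 𝓘(ℝ, E) y (i c) e) ∈ B c := (B c).sub_mem he (h1 _)
  obtain ⟨v, hv⟩ := ((hVc c (hUV hc)).2.2 (e - σ c (mvfderiv 𝓘(ℝ, E) y (i c) e))).1 (by
    rw [map_sub, h2 e he, sub_self])
  refine ⟨v, ?_, hv.symm⟩
  change mfderiv 𝓘(ℝ, E') 𝓘(ℝ, E) i c v ∈ B c
  have hv' : mfderiv 𝓘(ℝ, E') 𝓘(ℝ, E) i c v = e - σ c (mvfderiv 𝓘(ℝ, E) y (i c) e) := hv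
  rwa [hv']

/-- A smooth function on `C` whose differential kills `TC ∩ B` extends, locally in `M`, to a smooth
function whose differential kills `B`, namely to `g ∘ r - d(g ∘ r)(σ y)`. -/
theorem exists_local_extension {i : C → M}
    (hi : Manifold.IsSmoothEmbedding 𝓘(ℝ, E') 𝓘(ℝ, E) ∞ i)
    {B : ∀ c : C, Submodule ℝ (TangentSpace 𝓘(ℝ, E) (i c))}
    (hB : IsSmoothSubbundle 𝓘(ℝ, E) 𝓘(ℝ, E') i B)
    (hrank : HasConstantRank 𝓘(ℝ, E') (interTangent 𝓘(ℝ, E) 𝓘(ℝ, E') i B))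
    {g : C → ℝ} (hg : ContMDiff 𝓘(ℝ, E') 𝓘(ℝ, ℝ) ∞ g)
    (hgF : ∀ c, ∀ v ∈ interTangent 𝓘(ℝ, E) 𝓘(ℝ, E') i B c, mvfderiv 𝓘(ℝ, E') g c v = 0)
    (c₀ : C) :
    ∃ (V : Set M) (f : M → ℝ), IsOpen V ∧ i c₀ ∈ V ∧ ContMDiffOn 𝓘(ℝ, E) 𝓘(ℝ, ℝ) ∞ f V ∧
      ∀ c, i c ∈ V → f (i c) = g c ∧ ∀ e ∈ B c, mvfderiv 𝓘(ℝ, E) f (i c) e = 0 := by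
  obtain ⟨V, r, y, U, σ, hV, hc₀, hr, hy, hVc, hU, hcU, hUV, hσ, hUc⟩ :=
    exists_local_retraction_and_splitting hi hB hrank c₀
  have hism := hi.contMDiff
  let b := Module.finBasis ℝ E
  let φ : Fin (Module.finrank ℝ E) → E →L[ℝ] ℝ := fun j =>
    LinearMap.toContinuousLinearMap (b.coord j)
  have hφ : ∀ v : E, ∑ j, φ j v • b j = v := fun v => b.sum_repr v
  have hgr : ContMDiffOn 𝓘(ℝ, E) 𝓘(ℝ, ℝ) ∞ (fun p => g (r p)) V := hg.comp_contMDiffOn hr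
  -- the coefficients of `d(g ∘ r) ∘ σ` in the basis `b`
  let h : Fin (Module.finrank ℝ E) → C → ℝ := fun j c =>
    mvfderiv 𝓘(ℝ, E) (fun p => g (r p)) (i c) (σ c (b j))
  have hh : ∀ j, ContMDiffOn 𝓘(ℝ, E') 𝓘(ℝ, ℝ) ∞ (h j) U := fun j c hc =>
    (contMDiffAt_mvfderiv_section hV hgr (hUV hc)
      (hσ (fun _ => b j) c hc contMDiffAt_const)).contMDiffWithinAt
  have hW : IsOpen (V ∩ r ⁻¹' U) := hr.continuousOn.isOpen_inter_preimage hV hU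
  have hφy : ∀ j, ContMDiffOn 𝓘(ℝ, E) 𝓘(ℝ, ℝ) ∞ (fun p => φ j (y p)) (V ∩ r ⁻¹' U) := fun j =>
    (φ j).contMDiff.comp_contMDiffOn (hy.mono Set.inter_subset_left)
  have hhr : ∀ j, ContMDiffOn 𝓘(ℝ, E) 𝓘(ℝ, ℝ) ∞ (fun p => h j (r p)) (V ∩ r ⁻¹' U) := fun j =>
    (hh j).comp (hr.mono Set.inter_subset_left) fun p hp => hp.2
  refine ⟨V ∩ r ⁻¹' U, fun p => g (r p) - ∑ j, φ j (y p) * h j (r p), hW,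
    ⟨hc₀, by simpa [(hVc c₀ hc₀).1] using hcU⟩,
    (hgr.mono Set.inter_subset_left).sub
      (contMDiffOn_finsetSum fun j _ => (hφy j).mul (hhr j)), ?_⟩
  rintro c hc
  obtain ⟨hrc, hyc, hrd⟩ := hVc c hc.1
  have hcU : c ∈ U := by simpa [hrc] using hc.2
  refine ⟨by simp [hrc, hyc], fun e he => ?_⟩
  have hd1 : MDifferentiableAt 𝓘(ℝ, E) 𝓘(ℝ, ℝ) (fun p => g (r p)) (i c) :=
    (hgr.contMDiffAt (hV.mem_nhds hc.1)).mdifferentiableAt (by simp)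
  have hd2 : ∀ j, MDifferentiableAt 𝓘(ℝ, E) 𝓘(ℝ, ℝ) (fun p => φ j (y p)) (i c) := fun j =>
    ((hφy j).contMDiffAt (hW.mem_nhds hc)).mdifferentiableAt (by simp)
  have hd3 : ∀ j, MDifferentiableAt 𝓘(ℝ, E) 𝓘(ℝ, ℝ) (fun p => h j (r p)) (i c) := fun j =>
    ((hhr j).contMDiffAt (hW.mem_nhds hc)).mdifferentiableAt (by simp)
  have hd4 : ∀ j, MDifferentiableAt 𝓘(ℝ, E) 𝓘(ℝ, ℝ) (fun p => φ j (y p) * h j (r p)) (i c) :=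
    fun j => ((hφy j).mul (hhr j)).contMDiffAt (hW.mem_nhds hc) |>.mdifferentiableAt (by simp)
  have hd5 : MDifferentiableAt 𝓘(ℝ, E) 𝓘(ℝ, ℝ) (fun p => ∑ j, φ j (y p) * h j (r p)) (i c) :=
    (contMDiffOn_finsetSum fun j _ => (hφy j).mul (hhr j)).contMDiffAt (hW.mem_nhds hc)
      |>.mdifferentiableAt (by simp)
  have hyd : MDifferentiableAt 𝓘(ℝ, E) 𝓘(ℝ, E) y (i c) :=
    (hy.contMDiffAt (hV.mem_nhds hc.1)).mdifferentiableAt (by simp)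
  rw [mvfderiv_sub_apply hd1 hd5, mvfderiv_finset_sum _ fun j _ => hd4 j]
  -- as `y` vanishes on `C`, the derivatives of the coefficients `h j` do not contribute
  have hterm : ∀ j, mvfderiv 𝓘(ℝ, E) (fun p => φ j (y p) * h j (r p)) (i c) e =
      φ j (mvfderiv 𝓘(ℝ, E) y (i c) e) * h j c := by
    intro j
    rw [mvfderiv_mul_apply (hd2 j) (hd3 j), mvfderiv_clm_comp (φ j) hyd, hyc, hrc, map_zero,
      zero_mul, zero_add, mul_comm]
  have hsum : ∑ j, φ j (mvfderiv 𝓘(ℝ, E) y (i c) e) * h j c =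
      mvfderiv 𝓘(ℝ, E) (fun p => g (r p)) (i c) (σ c (mvfderiv 𝓘(ℝ, E) y (i c) e)) := by
    conv_rhs => rw [← hφ (mvfderiv 𝓘(ℝ, E) y (i c) e)]
    simp [h, map_sum]
  rw [Finset.sum_congr rfl fun j _ => hterm j, hsum, ← map_sub]
  obtain ⟨v, hv, hev⟩ := hUc c hcU e he
  rw [hev, ← mvfderiv_comp_map c hd1 (hism.contMDiffAt.mdifferentiableAt (by simp))]
  have hloc : ((fun p => g (r p)) ∘ i) =ᶠ[𝓝 c] g := by
    filter_upwards [(hV.preimage hism.continuous).mem_nhds hc.1] with c' hc'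
    simp [(hVc c' hc').1]
  rw [mvfderiv_congr hloc, hgF c v hv]

end Extension

/-! ### Vector fields and curves tangent to `TC ∩ B` -/

section TangentCurves

variable {E E' : Type*} [NormedAddCommGroup E] [NormedSpace ℝ E] [FiniteDimensional ℝ E]
  [NormedAddCommGroup E'] [NormedSpace ℝ E']
  {M : Type*} [TopologicalSpace M] [ChartedSpace E M] [IsManifold 𝓘(ℝ, E) ∞ M]
  {C : Type*} [TopologicalSpace C] [ChartedSpace E' C] [IsManifold 𝓘(ℝ, E') ∞ C]

/-- Every vector of `TC ∩ B` is the value of a local smooth vector field with values in `TC ∩ B`: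
extend it to a section `w` of `B` and take `w - σ (dy w)`. -/
theorem exists_vectorField_mem_interTangent {i : C → M}
    (hi : Manifold.IsSmoothEmbedding 𝓘(ℝ, E') 𝓘(ℝ, E) ∞ i)
    {B : ∀ c : C, Submodule ℝ (TangentSpace 𝓘(ℝ, E) (i c))}
    (hB : IsSmoothSubbundle 𝓘(ℝ, E) 𝓘(ℝ, E') i B)
    (hrank : HasConstantRank 𝓘(ℝ, E') (interTangent 𝓘(ℝ, E) 𝓘(ℝ, E') i B)) {c₀ : C}
    {v₀ : TangentSpace 𝓘(ℝ, E') c₀} (hv₀ : v₀ ∈ interTangent 𝓘(ℝ, E) 𝓘(ℝ, E') i B c₀) :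
    ∃ X : ∀ c : C, TangentSpace 𝓘(ℝ, E') c,
      ContMDiffAt 𝓘(ℝ, E') 𝓘(ℝ, E').tangent ∞
        (fun c => (⟨c, X c⟩ : TangentBundle 𝓘(ℝ, E') C)) c₀ ∧
      X c₀ = v₀ ∧ ∀ᶠ c in 𝓝 c₀, X c ∈ interTangent 𝓘(ℝ, E) 𝓘(ℝ, E') i B c := by
  obtain ⟨V, r, y, U, σ, hV, hc₀, hr, hy, hVc, hU, hcU, hUV, hσ, hUc⟩ :=
    exists_local_retraction_and_splitting hi hB hrank c₀
  have hism := hi.contMDiff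
  obtain ⟨k, U₁, s, hU₁, hcU₁, hs, hspan⟩ := hB c₀
  have he₀ : mfderiv 𝓘(ℝ, E') 𝓘(ℝ, E) i c₀ v₀ ∈ B c₀ := hv₀
  rw [← (hspan c₀ hcU₁).2] at he₀
  obtain ⟨t, ht⟩ := (Submodule.mem_span_range_iff_exists_fun ℝ).1 he₀
  let w : ∀ c, TangentSpace 𝓘(ℝ, E) (i c) := fun c => ∑ l, t l • s l c
  have hw : ContMDiffAt 𝓘(ℝ, E') 𝓘(ℝ, E).tangent ∞
      (fun c => (⟨i c, w c⟩ : TangentBundle 𝓘(ℝ, E) M)) c₀ :=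
    contMDiffAt_sum_smul_section_along (a := fun l _ => t l) hism.contMDiffAt
      (fun l => contMDiffAt_const) fun l => (hs l).contMDiffAt (hU₁.mem_nhds hcU₁)
  have hwB : ∀ c ∈ U₁, w c ∈ B c := fun c hc => by
    rw [← (hspan c hc).2]
    exact Submodule.sum_mem _ fun l _ =>
      Submodule.smul_mem _ _ (Submodule.subset_span (Set.mem_range_self l))
  -- `u = σ (dy w)`, so `w - u` is tangent to `C`; at `c₀` it equals `w`, as `dy w` vanishes there
  let u : ∀ c, TangentSpace 𝓘(ℝ, E) (i c) := fun c => σ c (mvfderiv 𝓘(ℝ, E) y (i c) (w c))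
  have hu : ContMDiffAt 𝓘(ℝ, E') 𝓘(ℝ, E).tangent ∞
      (fun c => (⟨i c, u c⟩ : TangentBundle 𝓘(ℝ, E) M)) c₀ :=
    hσ _ c₀ hcU (contMDiffAt_mvfderiv_section hV hy hc₀ hw)
  have hVnhds : ∀ᶠ c in 𝓝 c₀, i c ∈ V := (hV.preimage hism.continuous).mem_nhds hc₀
  -- Pushing a section of `TM|_C` forward by the retraction gives a vector field on `C`.
  have hpush : ∀ z : ∀ c, TangentSpace 𝓘(ℝ, E) (i c), ContMDiffAt 𝓘(ℝ, E') 𝓘(ℝ, E).tangent ∞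
      (fun c => (⟨i c, z c⟩ : TangentBundle 𝓘(ℝ, E) M)) c₀ →
      ContMDiffAt 𝓘(ℝ, E') 𝓘(ℝ, E').tangent ∞
        (fun c => (⟨c, (mfderiv 𝓘(ℝ, E) 𝓘(ℝ, E') r (i c) (z c) : E')⟩ :
          TangentBundle 𝓘(ℝ, E') C)) c₀ := by
    intro z hz
    refine (contMDiffAt_mfderiv_section hV hr hc₀ hz).congr_of_eventuallyEq ?_
    filter_upwards [hVnhds] with c hc
    have hcast : ∀ (c' : C) (v : E'), c' = c →
        (⟨c, v⟩ : TangentBundle 𝓘(ℝ, E') C) = ⟨c', v⟩ := by rintro _ v rfl; rfl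
    exact hcast _ _ (hVc c hc).1
  let X : ∀ c : C, TangentSpace 𝓘(ℝ, E') c := fun c =>
    (mfderiv 𝓘(ℝ, E) 𝓘(ℝ, E') r (i c) (w c) : E') - (mfderiv 𝓘(ℝ, E) 𝓘(ℝ, E') r (i c) (u c) : E')
  have hX : ∀ c, X c = (mfderiv 𝓘(ℝ, E) 𝓘(ℝ, E') r (i c) (w c - u c) : E') := fun c =>
    (map_sub (mfderiv 𝓘(ℝ, E) 𝓘(ℝ, E') r (i c)) (w c) (u c)).symm
  have hXF : ∀ c ∈ U₁ ∩ U, X c ∈ interTangent 𝓘(ℝ, E) 𝓘(ℝ, E') i B c ∧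
      mfderiv 𝓘(ℝ, E') 𝓘(ℝ, E) i c (X c) = w c - u c := by
    intro c hc
    obtain ⟨v, hv, hwu⟩ := hUc c hc.2 (w c) (hwB c hc.1)
    have hXv : X c = v := by
      rw [hX, hwu]
      exact (hVc c (hUV hc.2)).2.2 v
    rw [hXv]
    exact ⟨hv, hwu.symm⟩
  refine ⟨X, ?_, ?_, ?_⟩
  · exact (hpush w hw).sub_section (hpush u hu)
  · have hy₀ : mvfderiv 𝓘(ℝ, E) y (i c₀) (w c₀) = 0 := by
      have hy0 : (y ∘ i) =ᶠ[𝓝 c₀] fun _ => 0 := by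
        filter_upwards [hVnhds] with c hc using (hVc c hc).2.1
      rw [show w c₀ = _ from ht, ← mvfderiv_comp_map c₀
        ((hy.contMDiffAt (hV.mem_nhds hc₀)).mdifferentiableAt (by simp))
        (hism.contMDiffAt.mdifferentiableAt (by simp)), mvfderiv_congr hy0, mvfderiv_const]
      rfl
    have hu₀ : u c₀ = 0 := by simp only [u, hy₀, map_zero]
    rw [hX, hu₀, sub_zero, show w c₀ = _ from ht]
    exact (hVc c₀ hc₀).2.2 v₀
  · filter_upwards [(hU₁.inter hU).mem_nhds ⟨hcU₁, hcU⟩] with c hc using (hXF c hc).1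

/-- A map that is constant along curves tangent to `F` is constant along the integral curves of any
vector field with values in `F`, so its differential kills the field. -/
theorem mfderiv_eq_zero_of_const_along_tangentCurves [FiniteDimensional ℝ E']
    {F : ∀ c : C, Submodule ℝ (TangentSpace 𝓘(ℝ, E') c)}
    {E'' H'' : Type*} [NormedAddCommGroup E''] [NormedSpace ℝ E''] [TopologicalSpace H'']
    {K : ModelWithCorners ℝ E'' H''} {N : Type*} [TopologicalSpace N] [ChartedSpace H'' N]
    {p : C → N} (hp : ∀ x y, JoinedByTangentCurve 𝓘(ℝ, E') F x y → p x = p y)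
    {X : ∀ c : C, TangentSpace 𝓘(ℝ, E') c} {c₀ : C}
    (hpd : MDifferentiableAt 𝓘(ℝ, E') K p c₀)
    (hX : ContMDiffAt 𝓘(ℝ, E') 𝓘(ℝ, E').tangent 1
        (fun c => (⟨c, X c⟩ : TangentBundle 𝓘(ℝ, E') C)) c₀)
    (hXF : ∀ᶠ c in 𝓝 c₀, X c ∈ F c) :
    mfderiv 𝓘(ℝ, E') K p c₀ (X c₀) = 0 := by
  have : CompleteSpace E' := FiniteDimensional.complete ℝ E'
  have : IsManifold 𝓘(ℝ, E') 1 C := IsManifold.of_le (n := ∞) (by simp)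
  obtain ⟨γ, rfl, hγ⟩ := exists_isMIntegralCurveAt_of_contMDiffAt_boundaryless 0 hX
  have hγ0 := hγ.hasMFDerivAt
  have hev : ∀ᶠ t in 𝓝 (0 : ℝ), X (γ t) ∈ F (γ t) ∧
      HasMFDerivAt 𝓘(ℝ, ℝ) 𝓘(ℝ, E') γ t ((1 : ℝ →L[ℝ] ℝ).smulRight (X (γ t))) :=
    (hγ0.continuousAt.eventually hXF).and hγ
  obtain ⟨ε, hε, hball⟩ := Metric.eventually_nhds_iff.1 hev
  have hconst : (p ∘ γ) =ᶠ[𝓝 0] fun _ => p (γ 0) := by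
    filter_upwards [Metric.ball_mem_nhds (0 : ℝ) hε] with a ha
    refine (hp _ _ ⟨fun τ => γ (a * τ), by simp, by simp, fun τ hτ => ?_⟩).symm
    have hdist : dist (a * τ) 0 < ε := by
      rw [Metric.mem_ball, dist_zero_right] at ha
      rw [dist_zero_right, norm_mul, Real.norm_of_nonneg hτ.1]
      exact (mul_le_of_le_one_right (norm_nonneg a) hτ.2).trans_lt ha
    obtain ⟨hmem, hder⟩ := hball hdist
    refine ⟨a • X (γ (a * τ)), Submodule.smul_mem _ _ hmem, ?_⟩
    have hmul : HasMFDerivAt 𝓘(ℝ, ℝ) 𝓘(ℝ, ℝ) (fun τ : ℝ => a * τ) τ (a • (1 : ℝ →L[ℝ] ℝ)) :=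
      ((hasFDerivAt_id τ).const_smul a).hasMFDerivAt
    have hcomp := hder.comp τ hmul
    have hscale : ∀ v : E', (1 : ℝ →L[ℝ] ℝ).smulRight (a • v) =
        ((1 : ℝ →L[ℝ] ℝ).smulRight v).comp (a • (1 : ℝ →L[ℝ] ℝ)) := fun v => by
      ext; simp
    exact (hcomp.congr_mfderiv (hscale (X (γ (a * τ)))).symm).hasMFDerivWithinAt
  have h1 := (hpd.hasMFDerivAt.comp (0 : ℝ) hγ0).mfderiv
  have h2 : mfderiv 𝓘(ℝ, ℝ) K (p ∘ γ) (0 : ℝ) = 0 := hconst.mfderiv_eq.trans mfderiv_const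
  have h3 := congrArg (fun T : ℝ →L[ℝ] E'' => T 1) (h1.symm.trans h2)
  have h4 : mfderiv 𝓘(ℝ, E') K p (γ 0) ((1 : ℝ) • X (γ 0)) = 0 := h3
  rwa [one_smul] at h4

end TangentCurves

/-! ### Global extension of functions -/

section GlobalExtension

variable {E E' : Type*} [NormedAddCommGroup E] [NormedSpace ℝ E] [FiniteDimensional ℝ E]
  [NormedAddCommGroup E'] [NormedSpace ℝ E']
  {M : Type*} [TopologicalSpace M] [T2Space M] [SigmaCompactSpace M] [ChartedSpace E M]
  [IsManifold 𝓘(ℝ, E) ∞ M]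
  {C : Type*} [TopologicalSpace C] [ChartedSpace E' C]

/-- Local extensions are glued by a partition of unity. It has to be one on all of `M`, so that the
sum of its members has zero differential also in directions transverse to `C`; off `C`, which is
closed, the zero function serves as local extension. -/
theorem exists_extension_mem_annihilatingFunctions {i : C → M}
    (hi : Manifold.IsSmoothEmbedding 𝓘(ℝ, E') 𝓘(ℝ, E) ∞ i) (hiC : IsClosed (Set.range i))
    {B : ∀ c : C, Submodule ℝ (TangentSpace 𝓘(ℝ, E) (i c))}
    (hB : IsSmoothSubbundle 𝓘(ℝ, E) 𝓘(ℝ, E') i B)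
    (hrank : HasConstantRank 𝓘(ℝ, E') (interTangent 𝓘(ℝ, E) 𝓘(ℝ, E') i B))
    {g : C → ℝ} (hg : ContMDiff 𝓘(ℝ, E') 𝓘(ℝ, ℝ) ∞ g)
    (hgF : ∀ c, ∀ v ∈ interTangent 𝓘(ℝ, E) 𝓘(ℝ, E') i B c, mvfderiv 𝓘(ℝ, E') g c v = 0) :
    ∃ f ∈ annihilatingFunctions 𝓘(ℝ, E) i B, ∀ c, f (i c) = g c := by
  have hloc : ∀ x : M, ∃ (V : Set M) (f : M → ℝ), IsOpen V ∧ x ∈ V ∧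
      ContMDiffOn 𝓘(ℝ, E) 𝓘(ℝ, ℝ) ∞ f V ∧
      ∀ c, i c ∈ V → f (i c) = g c ∧ ∀ e ∈ B c, mvfderiv 𝓘(ℝ, E) f (i c) e = 0 := by
    intro x
    by_cases hx : x ∈ Set.range i
    · obtain ⟨c₀, rfl⟩ := hx
      exact exists_local_extension hi hB hrank hg hgF c₀
    · exact ⟨(Set.range i)ᶜ, fun _ => 0, hiC.isOpen_compl, hx, contMDiffOn_const,
        fun c hc => (hc ⟨c, rfl⟩).elim⟩
  choose V f hV hxV hf hfc using hloc
  obtain ⟨ρ, hρ⟩ := SmoothPartitionOfUnity.exists_isSubordinate 𝓘(ℝ, E) isClosed_univ V hV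
    fun x _ => Set.mem_iUnion.2 ⟨x, hxV x⟩
  refine ⟨⟨fun x => ∑ᶠ j, ρ j x • f j x, hρ.contMDiff_finsum_smul hV hf⟩, ?_, ?_⟩
  · intro c
    rw [Submodule.mem_dualAnnihilator]
    intro e he
    rw [differential_apply]
    set t := ρ.fintsupport (i c) with ht
    have hmemV : ∀ j ∈ t, i c ∈ V j := fun j hj => hρ j ((ρ.mem_fintsupport_iff (i c) j).1 hj)
    have hsub := ρ.eventually_finsupport_subset (i c)
    have hsum : (fun x => ∑ᶠ j, ρ j x • f j x) =ᶠ[𝓝 (i c)] fun x => ∑ j ∈ t, ρ j x * f j x := by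
      filter_upwards [hsub] with z hz
      rw [← ρ.sum_finsupport_smul_eq_finsum]
      refine Finset.sum_subset hz fun j _ hj => ?_
      rw [ρ.mem_finsupport, Function.notMem_support] at hj
      rw [hj, zero_smul]
    have hone : (fun x => ∑ j ∈ t, ρ j x) =ᶠ[𝓝 (i c)] fun _ => 1 := by
      filter_upwards [hsub] with z hz
      exact ρ.sum_finsupport' z (Set.mem_univ z) hz
    have hρd : ∀ j, MDifferentiableAt 𝓘(ℝ, E) 𝓘(ℝ, ℝ) (ρ j) (i c) := fun j =>
      (ρ j).contMDiff.contMDiffAt.mdifferentiableAt (by simp)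
    have hfd : ∀ j ∈ t, MDifferentiableAt 𝓘(ℝ, E) 𝓘(ℝ, ℝ) (f j) (i c) := fun j hj =>
      ((hf j).contMDiffAt ((hV j).mem_nhds (hmemV j hj))).mdifferentiableAt (by simp)
    -- the `f j` share the value `g c`, so the terms with the `dρ j` add up to `g c * d(∑ ρ j) = 0`
    have hterm : ∀ j ∈ t, mvfderiv 𝓘(ℝ, E) (fun x => ρ j x * f j x) (i c) e =
        g c * mvfderiv 𝓘(ℝ, E) (ρ j) (i c) e := by
      intro j hj
      obtain ⟨h1, h2⟩ := hfc j c (hmemV j hj)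
      rw [mvfderiv_mul_apply (hρd j) (hfd j hj), h2 e he, h1, mul_zero, zero_add]
    change mvfderiv 𝓘(ℝ, E) (fun x => ∑ᶠ j, ρ j x • f j x) (i c) e = 0
    rw [mvfderiv_congr hsum, mvfderiv_finset_sum (f := fun j x => ρ j x * f j x) t
      fun j hj => (hρd j).mul (hfd j hj),
      Finset.sum_congr rfl hterm, ← Finset.mul_sum, ← mvfderiv_finset_sum t fun j _ => hρd j,
      mvfderiv_congr hone, mvfderiv_const]
    exact mul_zero _
  · intro c
    change ∑ᶠ j, ρ j (i c) • f j (i c) = g c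
    have h1 : ∀ j, ρ j (i c) • f j (i c) = ρ j (i c) • g c := by
      intro j
      by_cases hj : ρ j (i c) = 0
      · rw [hj, zero_smul, zero_smul]
      · rw [(hfc j c (hρ j (subset_tsupport _ hj))).1]
    rw [finsum_congr h1, ← finsum_smul, ρ.sum_eq_one (Set.mem_univ _), one_smul]

end GlobalExtension

/-! ### Smoothness on the target of a submersion -/

section Submersion

variable {E' E'' : Type*} [NormedAddCommGroup E'] [NormedSpace ℝ E'] [NormedAddCommGroup E'']
  [NormedSpace ℝ E''] {C : Type*} [TopologicalSpace C] [ChartedSpace E' C]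
  {N : Type*} [TopologicalSpace N] [ChartedSpace E'' N]

/-- A function on the target of a surjective submersion is smooth if its pullback is, because
submersions have smooth local sections. -/
theorem contMDiff_of_comp_isSubmersion {p : C → N}
    (hp : Manifold.IsSubmersion 𝓘(ℝ, E') 𝓘(ℝ, E'') ∞ p) (hsurj : Function.Surjective p)
    {W : Type*} [NormedAddCommGroup W] [NormedSpace ℝ W] {h : N → W}
    (hh : ContMDiff 𝓘(ℝ, E') 𝓘(ℝ, W) ∞ (h ∘ p)) : ContMDiff 𝓘(ℝ, E'') 𝓘(ℝ, W) ∞ h := by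
  intro z
  obtain ⟨c₀, rfl⟩ := hsurj z
  have S := hp.isSubmersionAt c₀
  set φ := S.domChart with hφ
  set ψ := S.codChart with hψ
  have hc₀ : c₀ ∈ φ.source := S.mem_domChart_source
  have hz₀ : p c₀ ∈ ψ.source := S.mem_codChart_source
  have hwr : ∀ c ∈ φ.source, ψ (p c) = (S.equiv (φ c)).1 := by
    intro c hc
    have hmem : φ c ∈ (φ.extend 𝓘(ℝ, E')).target := by simpa using φ.map_source hc
    have hw := S.writtenInCharts hmem
    simpa [← hφ, ← hψ, φ.left_inv hc] using hw
  -- the local section keeps the fibre coordinate of `c₀`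
  let ι : E'' → E' := fun u => S.equiv.symm (u, (S.equiv (φ c₀)).2)
  have hι : ContMDiff 𝓘(ℝ, E'') 𝓘(ℝ, E') ∞ ι :=
    (S.equiv.symm.contDiff.comp (contDiff_prodMk_left _)).contMDiff
  have hι₀ : ι (ψ (p c₀)) = φ c₀ := by simp [ι, hwr c₀ hc₀]
  have hO : IsOpen (ψ.source ∩ ψ ⁻¹' (ι ⁻¹' φ.target)) :=
    ψ.isOpen_inter_preimage (φ.open_target.preimage hι.continuous)
  have hτ : ContMDiffOn 𝓘(ℝ, E'') 𝓘(ℝ, E') ∞ (fun z => φ.symm (ι (ψ z)))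
      (ψ.source ∩ ψ ⁻¹' (ι ⁻¹' φ.target)) := by
    have h1 : ContMDiffOn 𝓘(ℝ, E'') 𝓘(ℝ, E'') ∞ ψ ψ.source :=
      contMDiffOn_of_mem_maximalAtlas S.codChart_mem_maximalAtlas
    have h2 : ContMDiffOn 𝓘(ℝ, E') 𝓘(ℝ, E') ∞ φ.symm φ.target :=
      contMDiffOn_symm_of_mem_maximalAtlas S.domChart_mem_maximalAtlas
    exact h2.comp (hι.comp_contMDiffOn (h1.mono fun z hz => hz.1)) fun z hz => hz.2
  have hmem : p c₀ ∈ ψ.source ∩ ψ ⁻¹' (ι ⁻¹' φ.target) := by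
    refine ⟨hz₀, ?_⟩
    change ι (ψ (p c₀)) ∈ φ.target
    rw [hι₀]
    exact φ.map_source hc₀
  have hloc : ContMDiffAt 𝓘(ℝ, E'') 𝓘(ℝ, W) ∞ (fun z => (h ∘ p) (φ.symm (ι (ψ z)))) (p c₀) :=
    (hh.comp_contMDiffOn hτ).contMDiffAt (hO.mem_nhds hmem)
  refine hloc.congr_of_eventuallyEq ?_
  filter_upwards [hO.mem_nhds hmem] with z hz
  have hτz : φ.symm (ι (ψ z)) ∈ φ.source := φ.map_target hz.2
  have hsec : p (φ.symm (ι (ψ z))) = z := by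
    refine ψ.injOn (S.source_subset_preimage_source hτz) hz.1 ?_
    rw [hwr _ hτz, φ.right_inv hz.2]
    simp [ι]
  change h z = h (p (φ.symm (ι (ψ z))))
  rw [hsec]

end Submersion

/-! ### Covectors as differentials of functions -/

section Covectors

variable {E : Type*} [NormedAddCommGroup E] [NormedSpace ℝ E] [FiniteDimensional ℝ E]
  {N : Type*} [TopologicalSpace N] [T2Space N] [ChartedSpace E N] [IsManifold 𝓘(ℝ, E) ∞ N]

/-- The linear function `α` in a chart, cut off by a bump function, has differential `α` at `z`. -/
theorem exists_differential_eq (z : N) (α : Module.Dual ℝ (TangentSpace 𝓘(ℝ, E) z)) :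
    ∃ f : C^∞⟮𝓘(ℝ, E), N; ℝ⟯, differential 𝓘(ℝ, E) f z = α := by
  let χ : SmoothBumpFunction 𝓘(ℝ, E) z := Classical.arbitrary _
  have hz := mem_chart_source E z
  let D := (mdifferentiable_chart (I := 𝓘(ℝ, E)) z).mfderiv hz
  let A : E →L[ℝ] ℝ := LinearMap.toContinuousLinearMap (α ∘ₗ D.symm.toLinearMap)
  have hψ : ContMDiffOn 𝓘(ℝ, E) 𝓘(ℝ, E) ∞ (chartAt E z) (chartAt E z).source := contMDiffOn_chart
  have hg : ContMDiffOn 𝓘(ℝ, E) 𝓘(ℝ, ℝ) ∞ (fun x => A (chartAt E z x)) (chartAt E z).source :=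
    A.contMDiff.comp_contMDiffOn hψ
  refine ⟨⟨fun x => χ x • A (chartAt E z x), χ.contMDiff_smul hg⟩, ?_⟩
  have hev : (fun x => χ x • A (chartAt E z x)) =ᶠ[𝓝 z] fun x => A (chartAt E z x) := by
    filter_upwards [χ.eventuallyEq_one] with x hx
    rw [hx]; exact one_smul _ _
  refine LinearMap.ext fun v => ?_
  change mvfderiv 𝓘(ℝ, E) (fun x => χ x • A (chartAt E z x)) z v = α v
  rw [mvfderiv_congr hev, mvfderiv_clm_comp A
    ((hψ.contMDiffAt ((chartAt E z).open_source.mem_nhds hz)).mdifferentiableAt (by simp))]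
  exact congrArg α (D.symm_apply_apply v)

end Covectors

/-! ### The reduced Poisson structure -/

section Reduction

variable {E E' E'' : Type*} [NormedAddCommGroup E] [NormedSpace ℝ E]
  [NormedAddCommGroup E'] [NormedSpace ℝ E'] [NormedAddCommGroup E''] [NormedSpace ℝ E'']
  {M : Type*} [TopologicalSpace M] [ChartedSpace E M]
  {C : Type*} [TopologicalSpace C] [ChartedSpace E' C]
  {N : Type*} [TopologicalSpace N] [ChartedSpace E'' N]

theorem differential_comp_mfderiv {i : C → M} (hi : ContMDiff 𝓘(ℝ, E') 𝓘(ℝ, E) ∞ i)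
    (f : C^∞⟮𝓘(ℝ, E), M; ℝ⟯) (c : C) (v : TangentSpace 𝓘(ℝ, E') c) :
    differential 𝓘(ℝ, E) f (i c) (mfderiv 𝓘(ℝ, E') 𝓘(ℝ, E) i c v) =
      mvfderiv 𝓘(ℝ, E') (f ∘ i) c v :=
  (mvfderiv_comp_map c (f.contMDiff.contMDiffAt.mdifferentiableAt (by simp))
    (hi.contMDiffAt.mdifferentiableAt (by simp)) v).symm

variable [FiniteDimensional ℝ E]

/-- `π(ξ, η) = -⟨ξ, ♯η⟩`, and `♯η ∈ T` is annihilated by `ξ`. -/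
theorem BivectorField.toForm_eq_zero_of_sharp_le (π : BivectorField 𝓘(ℝ, E) M) {x : M}
    {T B : Submodule ℝ (TangentSpace 𝓘(ℝ, E) x)} (hsharp : B.dualAnnihilator.map (π.sharp x) ≤ T)
    {ξ η : Module.Dual ℝ (TangentSpace 𝓘(ℝ, E) x)} (hξ : ξ ∈ T.dualAnnihilator)
    (hη : η ∈ B.dualAnnihilator) : π.toForm x ξ η = 0 := by
  have h1 : π.toForm x η ξ = 0 := by
    rw [← π.apply_sharp]
    exact (Submodule.mem_dualAnnihilator ξ).1 hξ _ (hsharp ⟨η, hη, rfl⟩)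
  exact (π.isAlt x).isRefl _ _ h1

/-- On `C`, the bracket with a function in `C^∞_B(M)` only depends on the restriction of the other
argument to `C`. That argument need not lie in `C^∞_B(M)`. -/
theorem BivectorField.bracket_congr_left (π : BivectorField 𝓘(ℝ, E) M) {i : C → M}
    (hi : ContMDiff 𝓘(ℝ, E') 𝓘(ℝ, E) ∞ i)
    {B : ∀ c : C, Submodule ℝ (TangentSpace 𝓘(ℝ, E) (i c))}
    (hsharp : ∀ c, (B c).dualAnnihilator.map (π.sharp (i c)) ≤
      tangentAlong 𝓘(ℝ, E) 𝓘(ℝ, E') i c)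
    {f₁ f₂ g : C^∞⟮𝓘(ℝ, E), M; ℝ⟯} (h : ∀ c, f₁ (i c) = f₂ (i c))
    (hg : g ∈ annihilatingFunctions 𝓘(ℝ, E) i B) (c : C) :
    π.bracket f₁ g (i c) = π.bracket f₂ g (i c) := by
  have hmem : differential 𝓘(ℝ, E) f₁ (i c) - differential 𝓘(ℝ, E) f₂ (i c) ∈
      (tangentAlong 𝓘(ℝ, E) 𝓘(ℝ, E') i c).dualAnnihilator := by
    rw [Submodule.mem_dualAnnihilator]
    rintro _ ⟨v, rfl⟩
    have h1 : (f₁ ∘ i : C → ℝ) = f₂ ∘ i := funext h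
    have h2 := differential_comp_mfderiv hi f₁ c v
    rw [h1, ← differential_comp_mfderiv hi f₂ c v] at h2
    exact sub_eq_zero.2 h2
  have h0 := π.toForm_eq_zero_of_sharp_le (hsharp c) hmem (hg c)
  rw [map_sub, LinearMap.sub_apply, sub_eq_zero] at h0
  exact h0

/-- A function on `M` lifts a function on `N` (the quotient of `C` by `p`) if its restriction to
`C` is the pullback of the latter and its differential annihilates `B` along `C`. -/
def IsLift (i : C → M) (p : C → N) (B : ∀ c : C, Submodule ℝ (TangentSpace 𝓘(ℝ, E) (i c)))
    (f' : C^∞⟮𝓘(ℝ, E), M; ℝ⟯) (f : C^∞⟮𝓘(ℝ, E''), N; ℝ⟯) : Prop :=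
  f' ∈ annihilatingFunctions 𝓘(ℝ, E) i B ∧ ∀ c, f' (i c) = f (p c)

variable [FiniteDimensional ℝ E''] [T2Space N] [IsManifold 𝓘(ℝ, E'') ∞ N]

/-- The form induced by `π` on the covectors of `N` at `p c`: each of them is represented by a
covector in `B°` with the same restriction to `TC`, and `π` does not depend on the choice. -/
theorem BivectorField.exists_reduced_form (π : BivectorField 𝓘(ℝ, E) M) {i : C → M}
    (hi : ContMDiff 𝓘(ℝ, E') 𝓘(ℝ, E) ∞ i) {p : C → N}
    (hp : ContMDiff 𝓘(ℝ, E') 𝓘(ℝ, E'') ∞ p)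
    {B : ∀ c : C, Submodule ℝ (TangentSpace 𝓘(ℝ, E) (i c))}
    (hsharp : ∀ c, (B c).dualAnnihilator.map (π.sharp (i c)) ≤
      tangentAlong 𝓘(ℝ, E) 𝓘(ℝ, E') i c)
    (hlift : ∀ f : C^∞⟮𝓘(ℝ, E''), N; ℝ⟯, ∃ f' : C^∞⟮𝓘(ℝ, E), M; ℝ⟯, IsLift i p B f' f) (c : C) :
    ∃ Λ : LinearMap.BilinForm ℝ (Module.Dual ℝ (TangentSpace 𝓘(ℝ, E'') (p c))), Λ.IsAlt ∧
      ∀ (f g : C^∞⟮𝓘(ℝ, E''), N; ℝ⟯) (f' g' : C^∞⟮𝓘(ℝ, E), M; ℝ⟯),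
        IsLift i p B f' f → IsLift i p B g' g →
        Λ (differential 𝓘(ℝ, E'') f (p c)) (differential 𝓘(ℝ, E'') g (p c)) =
          π.bracket f' g' (i c) := by
  let di := (mfderiv 𝓘(ℝ, E') 𝓘(ℝ, E) i c).toLinearMap
  let dp := (mfderiv 𝓘(ℝ, E') 𝓘(ℝ, E'') p c).toLinearMap
  -- the pairs `(α, ξ)` with `ξ ∈ B°` and `ξ|_{TC} = p^* α`
  let P : Submodule ℝ (Module.Dual ℝ (TangentSpace 𝓘(ℝ, E'') (p c)) ×
      Module.Dual ℝ (TangentSpace 𝓘(ℝ, E) (i c))) :=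
    (B c).dualAnnihilator.comap (LinearMap.snd ℝ _ _) ⊓
      LinearMap.eqLocus (di.dualMap ∘ₗ LinearMap.snd ℝ _ _) (dp.dualMap ∘ₗ LinearMap.fst ℝ _ _)
  have hP : ∀ (f : C^∞⟮𝓘(ℝ, E''), N; ℝ⟯) (f' : C^∞⟮𝓘(ℝ, E), M; ℝ⟯), IsLift i p B f' f →
      (differential 𝓘(ℝ, E'') f (p c), differential 𝓘(ℝ, E) f' (i c)) ∈ P := by
    intro f f' hf
    refine ⟨hf.1 c, LinearMap.ext fun v => ?_⟩
    have h1 := differential_comp_mfderiv hi f' c v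
    rw [show (f' ∘ i : C → ℝ) = f ∘ p from funext hf.2] at h1
    exact h1.trans (differential_comp_mfderiv hp f c v).symm
  have hsurj : Function.Surjective (LinearMap.fst ℝ _ _ ∘ₗ P.subtype) := by
    intro α
    obtain ⟨f, rfl⟩ := exists_differential_eq (p c) α
    obtain ⟨f', hf'⟩ := hlift f
    exact ⟨⟨_, hP f f' hf'⟩, rfl⟩
  obtain ⟨L, hL⟩ := LinearMap.exists_rightInverse_of_surjective _ (LinearMap.range_eq_top.2 hsurj)
  let ℓ := LinearMap.snd ℝ _ _ ∘ₗ P.subtype ∘ₗ L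
  have hfst : ∀ α, (L α).1.1 = α := fun α => LinearMap.congr_fun hL α
  have hℓB : ∀ α, ℓ α ∈ (B c).dualAnnihilator := fun α => (L α).2.1
  -- two lifts of the same covector agree on `TC`
  have hdiff : ∀ α ξ, (α, ξ) ∈ P →
      ξ - ℓ α ∈ (tangentAlong 𝓘(ℝ, E) 𝓘(ℝ, E') i c).dualAnnihilator := by
    intro α ξ hξ
    rw [Submodule.mem_dualAnnihilator]
    rintro _ ⟨v, rfl⟩
    have h1 : ξ (di v) = α (dp v) := LinearMap.congr_fun hξ.2 v
    have h2 : ℓ α (di v) = (L α).1.1 (dp v) := LinearMap.congr_fun (L α).2.2 v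
    rw [hfst] at h2
    exact sub_eq_zero.2 (h1.trans h2.symm)
  refine ⟨(π.toForm (i c)).compl₁₂ ℓ ℓ, fun α => π.isAlt (i c) (ℓ α), ?_⟩
  intro f g f' g' hf hg
  have e1 := π.toForm_eq_zero_of_sharp_le (hsharp c) (hdiff _ _ (hP f f' hf)) (hg.1 c)
  have e2 := π.toForm_eq_zero_of_sharp_le (hsharp c) (hdiff _ _ (hP g g' hg)) (hℓB
    (differential 𝓘(ℝ, E'') f (p c)))
  replace e2 := (π.isAlt (i c)).isRefl _ _ e2
  rw [map_sub, LinearMap.sub_apply, sub_eq_zero] at e1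
  rw [map_sub, sub_eq_zero] at e2
  exact (e1.trans e2).symm

/-- Reduction along a surjective submersion `p : C → N`: the Poisson structure descends to `N` as
soon as functions on `N` have lifts and brackets of functions in `C^∞_B(M)` are, on `C`, pulled back
from `N`. -/
theorem PoissonStructure.existsUnique_reduced (π : PoissonStructure 𝓘(ℝ, E) M) {i : C → M}
    (hi : ContMDiff 𝓘(ℝ, E') 𝓘(ℝ, E) ∞ i) {p : C → N}
    (hp : Manifold.IsSubmersion 𝓘(ℝ, E') 𝓘(ℝ, E'') ∞ p) (hpsurj : Function.Surjective p)
    {B : ∀ c : C, Submodule ℝ (TangentSpace 𝓘(ℝ, E) (i c))}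
    (hsharp : ∀ c, (B c).dualAnnihilator.map (π.sharp (i c)) ≤
      tangentAlong 𝓘(ℝ, E) 𝓘(ℝ, E') i c)
    (hlift : ∀ f : C^∞⟮𝓘(ℝ, E''), N; ℝ⟯, ∃ f' : C^∞⟮𝓘(ℝ, E), M; ℝ⟯, IsLift i p B f' f)
    (hdesc : ∀ f' ∈ annihilatingFunctions 𝓘(ℝ, E) i B,
      ∀ g' ∈ annihilatingFunctions 𝓘(ℝ, E) i B,
      ∃ h : N → ℝ, ∀ c, h (p c) = π.bracket f' g' (i c)) :
    ∃! π' : PoissonStructure 𝓘(ℝ, E'') N, ∀ (f g : C^∞⟮𝓘(ℝ, E''), N; ℝ⟯)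
      (f' g' : C^∞⟮𝓘(ℝ, E), M; ℝ⟯), IsLift i p B f' f → IsLift i p B g' g →
        ∀ c, π'.bracket f g (p c) = π.bracket f' g' (i c) := by
  have hps : ContMDiff 𝓘(ℝ, E') 𝓘(ℝ, E'') ∞ p := fun c => (hp.isSubmersionAt c).contMDiffAt
  have hform : ∀ z : N, ∃ Λ : LinearMap.BilinForm ℝ (Module.Dual ℝ (TangentSpace 𝓘(ℝ, E'') z)),
      Λ.IsAlt ∧ ∀ (f g : C^∞⟮𝓘(ℝ, E''), N; ℝ⟯) (f' g' : C^∞⟮𝓘(ℝ, E), M; ℝ⟯),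
        IsLift i p B f' f → IsLift i p B g' g → ∀ c, p c = z →
        Λ (differential 𝓘(ℝ, E'') f z) (differential 𝓘(ℝ, E'') g z) = π.bracket f' g' (i c) := by
    intro z
    obtain ⟨c₀, rfl⟩ := hpsurj z
    obtain ⟨Λ, hΛ, h⟩ := π.exists_reduced_form hi hps hsharp hlift c₀
    refine ⟨Λ, hΛ, fun f g f' g' hf hg c hc => ?_⟩
    obtain ⟨u, hu⟩ := hdesc f' hf.1 g' hg.1
    rw [h f g f' g' hf hg, ← hu, ← hu, hc]
  choose Λ hΛ hΛlift using hform
  let β : BivectorField 𝓘(ℝ, E'') N :=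
    { toForm := Λ
      isAlt := hΛ
      smooth := fun f g => by
        obtain ⟨f', hf⟩ := hlift f
        obtain ⟨g', hg⟩ := hlift g
        refine contMDiff_of_comp_isSubmersion hp hpsurj ?_
        refine ((π.bracket f' g').contMDiff.comp hi).congr fun c => ?_
        exact hΛlift _ f g f' g' hf hg c rfl }
  have hβ : ∀ (f g : C^∞⟮𝓘(ℝ, E''), N; ℝ⟯) (f' g' : C^∞⟮𝓘(ℝ, E), M; ℝ⟯),
      IsLift i p B f' f → IsLift i p B g' g → ∀ c, β.bracket f g (p c) = π.bracket f' g' (i c) :=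
    fun f g f' g' hf hg c => hΛlift _ f g f' g' hf hg c rfl
  -- `{f', g'}` need not lie in `C^∞_B(M)`, but it agrees on `C` with a lift of `{f, g}`
  have hββ : ∀ (f g k : C^∞⟮𝓘(ℝ, E''), N; ℝ⟯) (f' g' k' : C^∞⟮𝓘(ℝ, E), M; ℝ⟯),
      IsLift i p B f' f → IsLift i p B g' g → IsLift i p B k' k → ∀ c,
      β.bracket (β.bracket f g) k (p c) = π.bracket (π.bracket f' g') k' (i c) := by
    intro f g k f' g' k' hf hg hk c
    obtain ⟨u', hu⟩ := hlift (β.bracket f g)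
    rw [hβ _ _ u' k' hu hk]
    exact π.bracket_congr_left hi hsharp
      (fun c => (hu.2 c).trans (hβ f g f' g' hf hg c)) hk.1 c
  refine ⟨{ toBivectorField := β, jacobi := fun f g k => ?_ }, hβ, ?_⟩
  · obtain ⟨f', hf⟩ := hlift f
    obtain ⟨g', hg⟩ := hlift g
    obtain ⟨k', hk⟩ := hlift k
    ext z
    obtain ⟨c, rfl⟩ := hpsurj z
    have h1 := congrArg (fun u : C^∞⟮𝓘(ℝ, E), M; ℝ⟯ => u (i c)) (π.jacobi f' g' k')
    have h2 : π.bracket (π.bracket f' g') k' (i c) + π.bracket (π.bracket g' k') f' (i c) +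
      π.bracket (π.bracket k' f') g' (i c) = 0 := h1
    rw [← hββ f g k f' g' k' hf hg hk, ← hββ g k f g' k' f' hg hk hf,
      ← hββ k f g k' f' g' hk hf hg] at h2
    exact h2
  · intro π₂ hπ₂
    have hform : π₂.toForm = Λ := by
      funext z
      obtain ⟨c, rfl⟩ := hpsurj z
      refine LinearMap.ext fun α => LinearMap.ext fun γ => ?_
      obtain ⟨f, rfl⟩ := exists_differential_eq (p c) α
      obtain ⟨g, rfl⟩ := exists_differential_eq (p c) γ
      obtain ⟨f', hf⟩ := hlift f
      obtain ⟨g', hg⟩ := hlift g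
      exact (hπ₂ f g f' g' hf hg c).trans (hβ f g f' g' hf hg c).symm
    obtain ⟨⟨Λ₂, _, _⟩, _⟩ := π₂
    cases hform
    rfl

end Reduction

/-! ### Functions on the leaf space -/

section Leaves

variable {E' : Type*} [NormedAddCommGroup E'] [NormedSpace ℝ E']
  {C : Type*} [TopologicalSpace C] [ChartedSpace E' C]
  {F : ∀ c : C, Submodule ℝ (TangentSpace 𝓘(ℝ, E') c)}

theorem JoinedByTangentCurve.eq_of_mvfderiv_eq_zero {g : C → ℝ}
    (hg : MDifferentiable 𝓘(ℝ, E') 𝓘(ℝ, ℝ) g)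
    (hgF : ∀ c, ∀ v ∈ F c, mvfderiv 𝓘(ℝ, E') g c v = 0) {x y : C}
    (h : JoinedByTangentCurve 𝓘(ℝ, E') F x y) : g x = g y := by
  obtain ⟨γ, rfl, rfl, hγ⟩ := h
  have hder : ∀ t ∈ Set.Icc (0 : ℝ) 1,
      HasFDerivWithinAt (g ∘ γ) (0 : ℝ →L[ℝ] ℝ) (Set.Icc 0 1) t := by
    intro t ht
    obtain ⟨v, hv, hvt⟩ := hγ t ht
    have h1 := ((hg (γ t)).hasMFDerivAt.comp_hasMFDerivWithinAt t hvt).hasFDerivWithinAt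
    refine h1.congr_fderiv (ContinuousLinearMap.ext fun (b : ℝ) => ?_)
    have h2 : mvfderiv 𝓘(ℝ, E') g (γ t) (b • v) = 0 := by rw [map_smul, hgF _ v hv, smul_zero]
    exact h2
  have huniq := uniqueDiffOn_Icc (zero_lt_one' ℝ)
  exact (convex_Icc (0 : ℝ) 1).is_const_of_fderivWithin_eq_zero (𝕜 := ℝ)
    (fun t ht => (hder t ht).differentiableWithinAt)
    (fun t ht => (hder t ht).fderivWithin (huniq t ht))
    (Set.left_mem_Icc.2 zero_le_one) (Set.right_mem_Icc.2 zero_le_one)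

theorem exists_leafSpace_factorization {g : C → ℝ} (hg : MDifferentiable 𝓘(ℝ, E') 𝓘(ℝ, ℝ) g)
    (hgF : ∀ c, ∀ v ∈ F c, mvfderiv 𝓘(ℝ, E') g c v = 0) :
    ∃ h : LeafSpace 𝓘(ℝ, E') F → ℝ, ∀ c, h (LeafSpace.proj 𝓘(ℝ, E') F c) = g c := by
  refine ⟨Quotient.lift g fun a b hab => ?_, fun c => rfl⟩
  have hab' : Relation.EqvGen (JoinedByTangentCurve 𝓘(ℝ, E') F) a b := hab
  induction hab' with
  | rel x y h => exact h.eq_of_mvfderiv_eq_zero hg hgF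
  | refl x => rfl
  | symm x y h ih => exact (ih h).symm
  | trans x y z h₁ h₂ ih₁ ih₂ => exact (ih₁ h₁).trans (ih₂ h₂)

theorem LeafSpace.proj_surjective : Function.Surjective (LeafSpace.proj 𝓘(ℝ, E') F) :=
  Quotient.mk_surjective

theorem JoinedByTangentCurve.proj_eq {x y : C} (h : JoinedByTangentCurve 𝓘(ℝ, E') F x y) :
    LeafSpace.proj 𝓘(ℝ, E') F x = LeafSpace.proj 𝓘(ℝ, E') F y :=
  Quotient.sound (s := leafSetoid 𝓘(ℝ, E') F) (Relation.EqvGen.rel _ _ h)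

end Leaves
end PoissonReduction

open PoissonReduction in
theorem mainTheorem3 {m n q : ℕ}
    -- the Poisson manifold `(M, π)`
    {M : Type*} [TopologicalSpace M] [T2Space M] [SecondCountableTopology M]
    [ChartedSpace (EuclideanSpace ℝ (Fin m)) M] [IsManifold (𝓡 m) ∞ M]
    (π : PoissonStructure (𝓡 m) M)
    -- the closed embedded submanifold `i : C → M`
    {C : Type*} [TopologicalSpace C]
    [ChartedSpace (EuclideanSpace ℝ (Fin n)) C] [IsManifold (𝓡 n) ∞ C]
    (i : C → M) (hi : Manifold.IsSmoothEmbedding (𝓡 n) (𝓡 m) ∞ i) (hiC : IsClosed (Set.range i))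
    -- the subbundle `E` of `TM|_C`
    (E : ∀ c : C, Submodule ℝ (TangentSpace (𝓡 m) (i c)))
    (hE : IsSmoothSubbundle (𝓡 m) (𝓡 n) i E)
    -- the distribution `F = TC ∩ E` on `C`
    (F : ∀ c : C, Submodule ℝ (TangentSpace (𝓡 n) c))
    (hF : F = interTangent (𝓡 m) (𝓡 n) i E)
    (hFrank : HasConstantRank (𝓡 n) F)
    (hFinv : IsInvolutive (𝓡 n) F)
    -- the quotient `C / F` is a smooth manifold and the projection is a submersion
    [T2Space (LeafSpace (𝓡 n) F)]
    [ChartedSpace (EuclideanSpace ℝ (Fin q)) (LeafSpace (𝓡 n) F)]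
    [IsManifold (𝓡 q) ∞ (LeafSpace (𝓡 n) F)]
    (hproj : Manifold.IsSubmersion (𝓡 n) (𝓡 q) ∞
      (LeafSpace.proj (𝓡 n) F))
    -- `♯ E° ⊆ TC`
    (hsharp : ∀ c : C,
      (E c).dualAnnihilator.map (π.sharp (i c)) ≤ tangentAlong (𝓡 m) (𝓡 n) i c)
    -- `{C^∞_E(M), C^∞_E(M)} ⊆ C^∞_F(M)`
    (hbracket : ∀ f ∈ annihilatingFunctions (𝓡 m) i E, ∀ g ∈ annihilatingFunctions (𝓡 m) i E,
      π.bracket f g ∈ annihilatingFunctions (𝓡 m) i (interAlong (𝓡 m) (𝓡 n) i E)) :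
    -- every function on `C / F` lifts to a function in `C^∞_E(M)`
    (∀ f : C^∞⟮𝓡 q, LeafSpace (𝓡 n) F; ℝ⟯,
      ∃ f' ∈ annihilatingFunctions (𝓡 m) i E,
        ∀ c, f' (i c) = f (LeafSpace.proj (𝓡 n) F c)) ∧
    -- and a unique Poisson structure on `C / F` has its bracket computed through such lifts
    ∃! π' : PoissonStructure (𝓡 q) (LeafSpace (𝓡 n) F),
      ∀ f g : C^∞⟮𝓡 q, LeafSpace (𝓡 n) F; ℝ⟯,
      ∀ f' ∈ annihilatingFunctions (𝓡 m) i E, ∀ g' ∈ annihilatingFunctions (𝓡 m) i E,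
        (∀ c, f' (i c) = f (LeafSpace.proj (𝓡 n) F c)) →
        (∀ c, g' (i c) = g (LeafSpace.proj (𝓡 n) F c)) →
        ∀ c, π'.bracket f g (LeafSpace.proj (𝓡 n) F c) =
          π.bracket f' g' (i c) := by
  have hrank : HasConstantRank (𝓡 n) (interTangent (𝓡 m) (𝓡 n) i E) := hF ▸ hFrank
  have hFmem : ∀ c v, v ∈ F c ↔ v ∈ interTangent (𝓡 m) (𝓡 n) i E c := fun c v => by rw [hF]
  have : LocallyCompactSpace M :=
    ChartedSpace.locallyCompactSpace (EuclideanSpace ℝ (Fin m)) M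
  have : SigmaCompactSpace M := inferInstance
  have hism := hi.contMDiff
  have hps : ContMDiff (𝓡 n) (𝓡 q) ∞ (LeafSpace.proj (𝓡 n) F) :=
    fun c => (hproj.isSubmersionAt c).contMDiffAt
  have hpd : MDifferentiable (𝓡 n) (𝓡 q) (LeafSpace.proj (𝓡 n) F) := hps.mdifferentiable (by simp)
  have hpF : ∀ c, ∀ v ∈ interTangent (𝓡 m) (𝓡 n) i E c,
      mfderiv (𝓡 n) (𝓡 q) (LeafSpace.proj (𝓡 n) F) c v = 0 := by
    intro c v hv
    obtain ⟨X, hX, rfl, hXF⟩ := exists_vectorField_mem_interTangent hi hE hrank hv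
    exact mfderiv_eq_zero_of_const_along_tangentCurves (F := F) (fun _ _ h => h.proj_eq) (hpd c)
      (hX.of_le (by simp)) (hXF.mono fun c hc => (hFmem c _).2 hc)
  have hlift : ∀ f : C^∞⟮𝓡 q, LeafSpace (𝓡 n) F; ℝ⟯,
      ∃ f' : C^∞⟮𝓡 m, M; ℝ⟯, IsLift i (LeafSpace.proj (𝓡 n) F) E f' f := by
    intro f
    obtain ⟨f', hf', h⟩ := exists_extension_mem_annihilatingFunctions hi hiC hE hrank
      (g := f ∘ LeafSpace.proj (𝓡 n) F) (f.contMDiff.comp hps) fun c v hv => by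
        rw [mvfderiv_comp_map c (f.contMDiff.contMDiffAt.mdifferentiableAt (by simp)) (hpd c),
          hpF c v hv, map_zero]
    exact ⟨f', hf', h⟩
  have hdesc : ∀ f' ∈ annihilatingFunctions (𝓡 m) i E, ∀ g' ∈ annihilatingFunctions (𝓡 m) i E,
      ∃ h : LeafSpace (𝓡 n) F → ℝ,
        ∀ c, h (LeafSpace.proj (𝓡 n) F c) = π.bracket f' g' (i c) := by
    intro f' hf g' hg
    refine exists_leafSpace_factorization (g := π.bracket f' g' ∘ i)
      (((π.bracket f' g').contMDiff.comp hism).mdifferentiable (by simp)) fun c v hv => ?_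
    rw [← differential_comp_mfderiv hism]
    exact (Submodule.mem_dualAnnihilator _).1 (hbracket f' hf g' hg c) _
      ⟨⟨v, rfl⟩, (hFmem c v).1 hv⟩
  refine ⟨fun f => ?_, ?_⟩
  · obtain ⟨f', h⟩ := hlift f
    exact ⟨f', h.1, h.2⟩
  obtain ⟨π', hπ', huniq⟩ := π.existsUnique_reduced hism hproj LeafSpace.proj_surjective
    hsharp hlift hdesc
  exact ⟨π', fun f g f' hf g' hg hff hgg => hπ' f g f' g' ⟨hf, hff⟩ ⟨hg, hgg⟩,
    fun π₂ h₂ => huniq π₂ fun f g f' g' hf hg => h₂ f g f' hf.1 g' hg.1 hf.2 hg.2⟩
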